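/- Setting (string-localized Yang–Mills/QCD, tree level). Let $f_{abc}$ be real completely antisymmetric structure constants of a Lie algebra, $[\xi_a,\xi_b]=if_{abc}\xi_c$, $\langle\xi_a|\xi_b\rangle=\delta_{ab}$, let $\pi$ be a finite-dimensional representation on quark colours (possibly zero: pure Yang–Mills), and let $F_{\mu\nu}$, $A_\mu=I^\nu F_{\mu\nu}$, $w$ be the Lie-algebra valued free massless Maxwell field, its string-localized potential ($I^\nu=I_c^\nu$ being the smeared string integration, $\partial_\mu I^\mu=-1$) and the field with $\delta_cA_\mu=\partial_\mu w$; let $j^\mu_a=\bar\psi\gamma^\mu\pi(\xi_a)\psi$ with a free massless Dirac field $\psi$. Put, with a real renormalization constant $c_F$ and primes denoting the arguments $x',x''$, $$L_1=\tfrac12\langle F^{\mu\nu}|i[A_\mu,A_\nu]\rangle+\langle A_\mu|j^\mu\rangle,\qquad Q_1^\mu=\langle F^{\mu\nu}|i[w,A_\nu]\rangle+\langle w|j^\mu\rangle,$$ $$L_2=-\tfrac12(1+c_F)\langle i[A^\mu,A^\nu]|i[A_\mu,A_\nu]\rangle,\qquad w_2(x,x')=i[w',A'_\nu]\,I^\nu\delta_{xx'},$$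 $$Q_2^\mu(x;x')=-2(1+c_F)\langle i[A^\mu,A^\nu]|i[w,A_\nu]\rangle\,\delta_{xx'}+2\Big\langle \frac{\partial Q_1^\mu}{\partial w}(x)\Big|w_2(x,x')\Big\rangle .$$ For Wick polynomials put $O_Y(X')=T[\partial_\mu Y^\mu X']-\partial_\mu T[Y^\mu X']$, and likewise $O_{Q(x;x')}(X'')=T[\partial^x_\mu Q^\mu(x;x')X'']-\partial^x_\mu T[Q^\mu(x;x')X'']$, where $T$ is the tree-level time-ordered product given by Wick's theorem. Here the undifferentiated propagators are the kinematic ones, obtained by string integration from $\langle TF_{\mu\nu}F'_{\kappa\lambda}\rangle=-\partial_{[\mu}\eta_{\nu][\kappa}\partial_{\lambda]}T_0-c_F\,\eta_{\mu[\kappa}\eta_{\lambda]\nu}\,i\delta_{xx'}$ (the $c_F$-term not being string-integrated), and $\langle T\psi\bar\psi'\rangle=i\gamma^\nu\partial_\nu T_0$, with $\square T_0=-i\delta$. The propagators of first derivatives are $\langle T\partial_\mu\varphi\chi'\rangle=\partial_\mu\langle T\varphi\chi'\rangle+O_\mu(\varphi,\chi')$ with any choice of the two-point obstructions $O_\mu(\varphi,\chi')$,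 which are (string-integrated, differentiated) delta functions, that is Lorentz covariant, respects the scaling dimension, has $O_\mu(w,\chi')=0$, and respects $\partial^\mu F_{\mu\nu}=0$, $\partial_\mu A_\nu-\partial_\nu A_\mu=F_{\mu\nu}$, $\partial^\mu A_\mu=0$; for the quark field, $O_\mu(\psi,\bar\psi')$ and $O_\mu(\bar\psi,\psi')$ are constant matrices times $i\delta_{xx'}$ such that the massless Dirac equation is respected. For arguments $Z(x,x')$ that contain kernels in $x-x'$, $T[Z(x,x')X'']$ is any extension that is linear and, on string-free $Z$, compatible with the support of $\delta_{xx'}$ and with the exchange $x\leftrightarrow x'$, and for which an undifferentiated factor $\delta_{xx'}$ can be taken out of $T$. Let $Z|_\delta$ denote the part of an expression $Z$ without string-integrated kernels, $Z|_{I\delta}=Z-Z|_\delta$, and $\mathfrak S$ the symmetrization in $x,x',x''$. The third-order obstruction $$O^{(3)}=3\,\mathfrak S\big(O_{Q_1}(L_2')\,\delta_{x'x''}+O_{Q_2(x;x')}(L_1'')\big)$$ is $3$ times the sum of the local part $$\text{(loc)}\quad \mathfrak S\big[O_{Q_1}(L_2')|_\delta\,\delta_{x'x''}+O_{Q_2(x;x')|_\delta}(L_1'')|_\delta\big]$$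 and the string-delta parts $$\text{(a)}\quad \mathfrak S\big[\langle w_2|O(\tfrac{\partial Q_2}{\partial w_2},L_1'')\rangle+O_{Q_1}(L_2')|_{I\delta}\,\delta_{x'x''}\big],\qquad \text{(b)}\quad \mathfrak S\big[\langle\tfrac{\partial Q_2}{\partial w_2}|O(w_2,L_1'')\rangle+O_{Q_2(x;x')|_\delta}(L_1'')|_{I\delta}\big],$$ where $\langle\frac{\partial Q_2}{\partial w_2}|O(w_2,L_1'')\rangle:=O_{Q_2|_{I\delta}}(L_1'')-\langle w_2|O(\frac{\partial Q_2}{\partial w_2},L_1'')\rangle$. Proposition. For all these choices: 1. The local part (loc) vanishes identically, using only the support properties of the delta functions. 2. If (a) and (b) are total derivatives (modulo the field equations, the anticommutativity of the quark fields, the string identities, $\square T_0=-i\delta$ and the support properties), then, modulo the same identities, the third-order obstruction is resolved with $L_3=0$: there is $Q_3^\mu(x;x',x'')$ such that $$O^{(3)}=\delta_cL_3\cdot\delta_{xx'x''}-\mathfrak S\,\partial_\mu Q_3^\mu\qquad\text{with } L_3=0 .$$ 3. If (a) and (b) are total derivatives of expressions that consist of string-integrated parts only, then $Q_3$ in 2.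 can be chosen with $Q_3|_\delta=0$. -/

import Mathlib

open MvPolynomial

namespace YMQCD

/-! ### Minkowski space -/

/-- Signature `(+,-,-,-)`: the diagonal entries of the metric. -/
noncomputable def sg (μ : Fin 4) : ℂ := if μ = 0 then 1 else -1

/-- The metric `η_{μν}`. -/
noncomputable def eta (μ ν : Fin 4) : ℂ := if μ = ν then sg μ else 0

/-- Proper orthochronous Lorentz matrices. -/
def IsLorentz (Λ : Matrix (Fin 4) (Fin 4) ℝ) : Prop :=
  Λ.transpose * Matrix.diagonal (fun μ : Fin 4 => if μ = 0 then (1 : ℝ) else -1) * Λ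
      = Matrix.diagonal (fun μ : Fin 4 => if μ = 0 then (1 : ℝ) else -1) ∧
    Λ.det = 1 ∧ 0 < Λ 0 0

/-! ### Two-point kernels

A two-point kernel is a polynomial in derivatives and string integrations that is applied to one
of the two distributions `T_0(x-x')` and `δ(x-x')`. -/

/-- The operators: `d μ = ∂_μ` acts on the first argument `x` (so `∂'_μ = -∂_μ`),
`I s μ = I_{c,μ}` is the string integration in the first (`s = false`) or in the second
(`s = true`) argument, and `K s μ ν` is the string operation `∫ dσ(e) b_μ(e) e_ν ∫ s ds` that
produces `w = K^{μν} F_{μν}` from `F`, in the respective argument. All indices are lower. -/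
inductive Op where
  | d (μ : Fin 4)
  | I (s : Bool) (μ : Fin 4)
  | K (s : Bool) (μ ν : Fin 4)

/-- Polynomials in the operators. -/
abbrev OpAlg := MvPolynomial Op ℂ

noncomputable def dd (μ : Fin 4) : OpAlg := X (Op.d μ)
noncomputable def II (s : Bool) (μ : Fin 4) : OpAlg := X (Op.I s μ)
noncomputable def KK (s : Bool) (μ ν : Fin 4) : OpAlg := X (Op.K s μ ν)

/-- The d'Alembert operator. -/
noncomputable def box : OpAlg := ∑ μ, C (sg μ) * dd μ * dd μ

/-- The identities `∂_μ I^μ = -1` and `∂_μ I'^μ = 1` (that is, `∂'_μ I'^μ = -1`). -/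
noncomputable def stringIdeal : Ideal OpAlg :=
  Ideal.span {(∑ μ, C (sg μ) * dd μ * II false μ) + 1, (∑ μ, C (sg μ) * dd μ * II true μ) - 1}

/-- The kernel `p T_0 + q (i δ)` vanishes: because of `□ T_0 = - i δ` it equals
`(p - q □) T_0`, up to the string identities. -/
def KernelVanishes (p q : OpAlg) : Prop := p - box * q ∈ stringIdeal

/-- Exchange of the two arguments of a kernel (`T_0` and `δ` are even). -/
noncomputable def opFlip : OpAlg →ₐ[ℂ] OpAlg :=
  aeval (fun o => match o with
    | Op.d μ => -dd μ
    | Op.I s μ => II (!s) μ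
    | Op.K s μ ν => KK (!s) μ ν)

/-- Lorentz transformation of the operators, as covectors and tensors. -/
noncomputable def opLorentz (Λ : Matrix (Fin 4) (Fin 4) ℝ) : OpAlg →ₐ[ℂ] OpAlg :=
  aeval (fun o => match o with
    | Op.d μ => ∑ μ', C (Λ μ' μ : ℂ) * dd μ'
    | Op.I s μ => ∑ μ', C (Λ μ' μ : ℂ) * II s μ'
    | Op.K s μ ν => ∑ μ', ∑ ν', C ((Λ μ' μ : ℂ) * (Λ ν' ν : ℂ)) * KK s μ' ν')

/-- Scaling dimension of the operators. -/
def opDim : Op → ℤ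
  | Op.d _ => 1
  | Op.I _ _ => -1
  | Op.K _ _ _ => -2

/-! ### Gluon fields and their time-ordered two-point functions -/

/-- The linear gluon fields, without colour index: `w`, `A_μ(c)` and `F_{μν}`. -/
inductive Species where
  | w
  | A (μ : Fin 4)
  | F (μ ν : Fin 4)
deriving DecidableEq, Fintype

/-- Scaling dimension of the fields. -/
def Species.dim : Species → ℤ
  | .w => 0
  | .A _ => 1
  | .F _ _ => 2

/-- Lorentz transformation of the fields, as covectors and tensors. -/
noncomputable def Species.lorentz (Λ : Matrix (Fin 4) (Fin 4) ℝ) : Species → Species → ℂ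
  | .w, .w => 1
  | .A μ', .A μ => Λ μ' μ
  | .F μ' ν', .F μ ν => (Λ μ' μ : ℂ) * (Λ ν' ν : ℂ)
  | _, _ => 0

/-- The expression of the fields through the Maxwell field: `φ = ∑ (fromF s φ α β) F_{αβ}`, with
`A_μ(c) = I^ν F_{μν}` and `w = K^{μν} F_{μν}`; `s` tells in which argument the strings act. -/
noncomputable def fromF (s : Bool) : Species → Fin 4 → Fin 4 → OpAlg
  | .w, α, β => C (sg α * sg β) * KK s α β
  | .A μ, α, β => if α = μ then C (sg β) * II s β else 0
  | .F μ ν, α, β => if α = μ ∧ β = ν then 1 else 0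

/-- `⟨T F_{μν} F'_{κλ}⟩ = - ∂_{[μ} η_{ν][κ} ∂_{λ]} T_0`, as operator acting on `T_0`. -/
noncomputable def propFF (μ ν κ l : Fin 4) : OpAlg :=
  -(C (eta ν κ) * dd μ * dd l - C (eta μ κ) * dd ν * dd l
    - C (eta ν l) * dd μ * dd κ + C (eta μ l) * dd ν * dd κ)

/-- The kinematic propagators `⟨T φ χ'⟩`, obtained from `⟨T F F'⟩` by string integration, as
operators acting on `T_0`. -/
noncomputable def prop (φ χ : Species) : OpAlg :=
  ∑ α, ∑ β, ∑ κ, ∑ l, fromF false φ α β * fromF true χ κ l * propFF α β κ l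

/-- The renormalization `- c_F η_{μ[κ} η_{λ]ν} i δ` of `⟨T F_{μν} F'_{κλ}⟩`, as operator acting on
`i δ`. -/
noncomputable def renorm (cF : ℝ) : Species → Species → OpAlg
  | .F μ ν, .F κ l => C (-(cF : ℂ) * (eta μ κ * eta l ν - eta μ l * eta κ ν))
  | _, _ => 0

/-- A choice of the time-ordered two-point functions of first derivatives of the gluon fields,
`⟨T ∂_μ φ χ'⟩ = ∂_μ ⟨T φ χ'⟩ + o μ φ χ (i δ_{xx'})`, that is, of the two-point obstructions
`O_μ(φ, χ') = o μ φ χ (i δ_{xx'})` as (string-integrated, differentiated) delta functions.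
It must be Lorentz covariant, respect the scaling dimension, be kinematic on `w`, and respect the
equations of motion `∂^μ F_{μν} = 0`, `∂_μ A_ν - ∂_ν A_μ = F_{μν}`, `∂^μ A_μ = 0` under the
time-ordering. -/
structure GluonOrdering (cF : ℝ) where
  o : Fin 4 → Species → Species → OpAlg
  covariant : ∀ Λ : Matrix (Fin 4) (Fin 4) ℝ, IsLorentz Λ → ∀ (μ : Fin 4) (φ χ : Species),
    opLorentz Λ (o μ φ χ) = ∑ μ' : Fin 4, ∑ φ' : Species, ∑ χ' : Species,
      C ((Λ μ' μ : ℂ) * φ'.lorentz Λ φ * χ'.lorentz Λ χ) * o μ' φ' χ'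
  scaling : ∀ (μ : Fin 4) (φ χ : Species),
    IsWeightedHomogeneous opDim (o μ φ χ) (φ.dim + χ.dim + 1 - 4)
  kinematic_w : ∀ (μ : Fin 4) (χ : Species), o μ .w χ = 0
  antisymm_left : ∀ (μ ν r : Fin 4) (χ : Species), o μ (.F ν r) χ = -o μ (.F r ν) χ
  antisymm_right : ∀ (μ ν r : Fin 4) (φ : Species), o μ φ (.F ν r) = -o μ φ (.F r ν)
  maxwell : ∀ (ν : Fin 4) (χ : Species), χ ≠ .w →
    KernelVanishes (∑ μ, C (sg μ) * dd μ * prop (.F μ ν) χ)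
      (∑ μ, C (sg μ) * (dd μ * renorm cF (.F μ ν) χ + o μ (.F μ ν) χ))
  curl : ∀ (μ ν : Fin 4) (χ : Species), χ ≠ .w →
    KernelVanishes (dd μ * prop (.A ν) χ - dd ν * prop (.A μ) χ - prop (.F μ ν) χ)
      ((dd μ * renorm cF (.A ν) χ + o μ (.A ν) χ) - (dd ν * renorm cF (.A μ) χ + o ν (.A μ) χ)
        - renorm cF (.F μ ν) χ)
  lorenz : ∀ χ : Species, χ ≠ .w →
    KernelVanishes (∑ μ, C (sg μ) * dd μ * prop (.A μ) χ)
      (∑ μ, C (sg μ) * (dd μ * renorm cF (.A μ) χ + o μ (.A μ) χ))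

/-! ### Gauge algebra, quarks -/

/-- The Lie algebra with `[ξ_a, ξ_b] = i f_{abc} ξ_c` (completely antisymmetric structure
constants, `⟨ξ_a|ξ_b⟩ = δ_{ab}`), its representation `T a = π(ξ_a)` on the quark colours, and
the Dirac matrices. The pure Yang-Mills case is `d = 0`. -/
structure GaugeData (N d : ℕ) where
  f : Fin N → Fin N → Fin N → ℝ
  antisymm₁₂ : ∀ a b c, f a b c = -f b a c
  antisymm₂₃ : ∀ a b c, f a b c = -f a c b
  jacobi : ∀ a b c g, ∑ e, (f a b e * f e c g + f b c e * f e a g + f c a e * f e b g) = 0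
  T : Fin N → Matrix (Fin d) (Fin d) ℂ
  T_comm : ∀ a b, T a * T b - T b * T a = ∑ c, (Complex.I * (f a b c : ℂ)) • T c
  γ : Fin 4 → Matrix (Fin 4) (Fin 4) ℂ
  clifford : ∀ μ ν, γ μ * γ ν + γ ν * γ μ = (2 * eta μ ν) • (1 : Matrix (Fin 4) (Fin 4) ℂ)

/-- A choice of the time-ordered two-point functions of first derivatives of the massless Dirac
field, with `⟨T ψ ψ̄'⟩ = i γ^ν ∂_ν T_0`. By scaling dimension, the two-point obstructions are
multiples of the delta function: `O_μ(ψ, ψ̄') = M μ (i δ_{xx'})` and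
`⟨T ψ' ∂_μ ψ̄⟩ - ∂_μ ⟨T ψ' ψ̄⟩ = M' μ (i δ_{xx'})`. The Dirac equations `γ^μ ∂_μ ψ = 0` and
`∂_μ ψ̄ γ^μ = 0` are respected. -/
structure QuarkOrdering {N d : ℕ} (G : GaugeData N d) where
  M : Fin 4 → Matrix (Fin 4) (Fin 4) ℂ
  M' : Fin 4 → Matrix (Fin 4) (Fin 4) ℂ
  dirac : ∀ s t : Fin 4,
    KernelVanishes (∑ μ, ∑ ν, C (Complex.I * (G.γ μ * G.γ ν) s t) * dd μ * dd ν)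
      (C (∑ μ, (G.γ μ * M μ) s t))
  dirac' : ∀ s t : Fin 4,
    KernelVanishes (∑ μ, ∑ ν, C (-Complex.I * (G.γ ν * G.γ μ) s t) * dd μ * dd ν)
      (C (∑ μ, (M' μ * G.γ μ) s t))

/-! ### Multilocal expressions

Polynomials in Wick-ordered fields at the points `x = x_0`, `x' = x_1`, `x'' = x_2`, with
coefficients that are products of kernels. -/

/-- Multi-indices of derivatives. -/
abbrev Multi := Fin 4 →₀ ℕ

/-- The two distributions on which the operators of a kernel act. -/
inductive Base where
  | T0
  | delta

/-- `field i φ a α` is `∂^α φ^a(x_i)`; `quark i j m n α β` is the Wick-ordered bilinear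
`:∂^α ψ̄_m(x_i) ∂^β ψ_n(x_j):` (`m`, `n` are pairs of a Dirac and a colour index; all expressions
contain the quark fields only through such bilinears, which commute);
`kernel b i j m` is the operator monomial `m` applied to `b(x_i - x_j)`. -/
inductive Gen (N d : ℕ) where
  | field (i : Fin 3) (φ : Species) (a : Fin N) (α : Multi)
  | quark (i j : Fin 3) (m n : Fin 4 × Fin d) (α β : Multi)
  | kernel (b : Base) (i j : Fin 3) (m : Op →₀ ℕ)

/-- The commutative algebra of multilocal expressions. -/
abbrev Expr (N d : ℕ) := MvPolynomial (Gen N d) ℂ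

variable {N d : ℕ}

/-- Changing the points. -/
def Gen.map (f : Fin 3 → Fin 3) : Gen N d → Gen N d
  | .field i φ a α => .field (f i) φ a α
  | .quark i j m n α β => .quark (f i) (f j) m n α β
  | .kernel b i j m => .kernel b (f i) (f j) m

/-- Permutation of the points. -/
noncomputable def relabel (σ : Equiv.Perm (Fin 3)) : Expr N d →ₐ[ℂ] Expr N d :=
  rename (Gen.map σ)

/-- Symmetrization (with weight one) in `x, x', x''`. -/
noncomputable def symm3 (Z : Expr N d) : Expr N d :=
  C (1 / 6 : ℂ) * ∑ σ : Equiv.Perm (Fin 3), relabel σ Z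

/-- The kernel `p b(x_i - x_j)`. -/
noncomputable def ker (b : Base) (i j : Fin 3) : OpAlg →ₗ[ℂ] Expr N d :=
  (basisMonomials Op ℂ).constr ℂ (fun m => (X (Gen.kernel b i j m) : Expr N d))

/-- `δ(x_i - x_j)`. -/
noncomputable def delta (i j : Fin 3) : Expr N d := ker .delta i j 1

/-- The derivative `∂_μ` with respect to the point `x_l`. -/
noncomputable def pd (l : Fin 3) (μ : Fin 4) : Derivation ℂ (Expr N d) (Expr N d) :=
  mkDerivation ℂ (fun g => match g with
    | .field i φ a α => if i = l then X (.field i φ a (α + Finsupp.single μ 1)) else 0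
    | .quark i j m n α β =>
        (if i = l then X (.quark i j m n (α + Finsupp.single μ 1) β) else 0)
          + (if j = l then X (.quark i j m n α (β + Finsupp.single μ 1)) else 0)
    | .kernel b i j m =>
        (if i = l then X (.kernel b i j (m + Finsupp.single (Op.d μ) 1)) else 0)
          - (if j = l then X (.kernel b i j (m + Finsupp.single (Op.d μ) 1)) else 0))

/-- The string variation `δ_c` on Wick polynomials: `δ_c A_μ = ∂_μ w`, and the other fields are
string-independent. -/
noncomputable def deltaC : Derivation ℂ (Expr N d) (Expr N d) :=
  mkDerivation ℂ (fun g => match g with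
    | .field i (.A μ) a α => X (.field i .w a (α + Finsupp.single μ 1))
    | _ => 0)

open Classical in
/-- The part `Z|_δ` without string-integrated kernels: all kernels that contain a string operator
are dropped. -/
noncomputable def deltaPart : Expr N d →ₐ[ℂ] Expr N d :=
  aeval (fun g => match g with
    | .kernel b i j m =>
        if ∀ o ∈ m.support, ∃ μ, o = Op.d μ then X (.kernel b i j m) else 0
    | g => X g)

/-- The part `Z|_{Iδ}` with string-integrated kernels. -/
noncomputable def stringPart (Z : Expr N d) : Expr N d := Z - deltaPart Z

/-- Wick polynomials at the point `x_i` in the fields and their derivatives of order `≤ k`. -/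
noncomputable def wick (i : Fin 3) (k : ℕ) : Subalgebra ℂ (Expr N d) :=
  supported ℂ {g | match g with
    | .field j _ _ α => j = i ∧ α.degree ≤ k
    | .quark j l _ _ α β => j = i ∧ l = i ∧ α.degree + β.degree ≤ k
    | .kernel _ _ _ _ => False}

/-! ### Identities between multilocal expressions -/

/-- The smallest ideal that contains `S` and is stable under all derivatives. -/
noncomputable def diffIdeal (S : Set (Expr N d)) : Ideal (Expr N d) :=
  sInf {J | S ⊆ J ∧ ∀ l μ, ∀ Z ∈ J, pd l μ Z ∈ J}

/-- The two points `x_i`, `x_j` are not linked by the kernel `g`. -/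
def Gen.NotLinking (i j : Fin 3) : Gen N d → Prop
  | .kernel _ k l _ => ¬ ((k = i ∨ k = j) ∧ (l = i ∨ l = j))
  | _ => True

/-- `f(x) δ_{xx'} = f(x') δ_{xx'}` for fields and kernels, and
`K(x,x') = (flip K)(x',x)` for kernels. -/
def supportRelations : Set (Expr N d) :=
  {Z | (∃ (i j : Fin 3) (g : Gen N d), i ≠ j ∧ g.NotLinking i j ∧
          Z = (X g - X (g.map (Function.update id i j))) * delta i j) ∨
       (∃ (b : Base) (i j : Fin 3) (p : OpAlg), i ≠ j ∧
          Z = ker b j i p - ker b i j (opFlip p))}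

/-- The ideal of consequences of the support properties of the delta function. -/
noncomputable def supportIdeal : Ideal (Expr N d) := diffIdeal supportRelations

/-- The field equations, the relations among the Wick-ordered quark bilinears (`ψ`, `ψ̄`
anticommute), the string identities, and `□ T_0 = - i δ`. -/
def fieldRelations (G : GaugeData N d) : Set (Expr N d) :=
  {Z | (∃ i a μ ν, Z = X (.field i (.F μ ν) a 0) + X (.field i (.F ν μ) a 0)) ∨
       (∃ i a ν, Z = ∑ μ, C (sg μ) * pd i μ (X (.field i (.F μ ν) a 0))) ∨
       (∃ i a μ ν, Z = pd i μ (X (.field i (.A ν) a 0)) - pd i ν (X (.field i (.A μ) a 0))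
          - X (.field i (.F μ ν) a 0)) ∨
       (∃ i a, Z = ∑ μ, C (sg μ) * pd i μ (X (.field i (.A μ) a 0))) ∨
       (∃ i a, Z = ∑ μ, C (sg μ) * pd i μ (pd i μ (X (.field i .w a 0)))) ∨
       (∃ (i j : Fin 3) (m : Fin 4 × Fin d) (s : Fin 4) (r : Fin d) (α β : Multi),
          Z = ∑ μ, ∑ t, C (G.γ μ s t)
            * X (.quark i j m (t, r) α (β + Finsupp.single μ 1))) ∨
       (∃ (i j : Fin 3) (n : Fin 4 × Fin d) (s : Fin 4) (r : Fin d) (α β : Multi),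
          Z = ∑ μ, ∑ t, C (G.γ μ t s)
            * X (.quark i j (t, r) n (α + Finsupp.single μ 1) β)) ∨
       (∃ i j k l m n m' n' α β α' β',
          Z = X (.quark i j m n α β) * X (.quark k l m' n' α' β')
            + X (.quark i l m n' α β') * X (.quark k j m' n α' β)) ∨
       (∃ (b : Base) (i j : Fin 3) (p : OpAlg), p ∈ stringIdeal ∧ Z = ker b i j p) ∨
       (∃ (i j : Fin 3) (p : OpAlg), i ≠ j ∧
          Z = ker .T0 i j (box * p) + C Complex.I * ker .delta i j p)}

/-- All identities. -/
noncomputable def onShellIdeal (G : GaugeData N d) : Ideal (Expr N d) :=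
  diffIdeal (supportRelations ∪ fieldRelations G)

/-! ### Time-ordered products and obstructions (tree level) -/

/-- The product of derivatives `∂^α`. -/
noncomputable def dPow (α : Multi) : OpAlg := α.prod (fun μ n => dd μ ^ n)

/-- `F μ` if `α` is the first-order multi-index of `∂_μ`, and `0` otherwise. -/
noncomputable def firstOrder (α : Multi) (F : Fin 4 → OpAlg) : OpAlg :=
  ∑ μ, if α = Finsupp.single μ 1 then F μ else 0

/-- The contraction `⟨T ∂^α φ(x_i) χ(x_j)⟩`. -/
noncomputable def gluonContraction {cF : ℝ} (P : GluonOrdering cF) (i j : Fin 3)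
    (φ χ : Species) (α : Multi) : Expr N d :=
  ker .T0 i j (dPow α * prop φ χ)
    + C Complex.I * ker .delta i j (dPow α * renorm cF φ χ + firstOrder α (fun μ => P.o μ φ χ))

/-- The contraction `⟨T ∂^β ψ_s(x_i) ψ̄_t(x_j)⟩` (Dirac indices). -/
noncomputable def quarkContraction {G : GaugeData N d} (P : QuarkOrdering G) (i j : Fin 3)
    (s t : Fin 4) (β : Multi) : Expr N d :=
  ker .T0 i j (dPow β * ∑ ν, C (Complex.I * G.γ ν s t) * dd ν)
    + C Complex.I * ker .delta i j (firstOrder β (fun μ => C (P.M μ s t)))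

/-- The contraction `⟨T ψ_s(x_j) ∂^α ψ̄_t(x_i)⟩` (Dirac indices). -/
noncomputable def quarkContraction' {G : GaugeData N d} (P : QuarkOrdering G) (i j : Fin 3)
    (s t : Fin 4) (α : Multi) : Expr N d :=
  ker .T0 i j (dPow α * ∑ ν, C (-Complex.I * G.γ ν s t) * dd ν)
    + C Complex.I * ker .delta i j (firstOrder α (fun μ => C (P.M' μ s t)))

open Classical in
/-- The single contraction of a field (or quark bilinear) in the first factor with one in the
second factor. Derivatives of fields occur only in the first factor. -/
noncomputable def pair {cF : ℝ} {G : GaugeData N d} (P : GluonOrdering cF) (R : QuarkOrdering G) :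
    Gen N d → Gen N d → Expr N d
  | .field i φ a α, .field j χ b β =>
      if a = b ∧ β = 0 then gluonContraction P i j φ χ α else 0
  | .quark i j m n α β, .quark k l m' n' α' β' =>
      if α' = 0 ∧ β' = 0 then
        (if n.2 = m'.2 then
          X (.quark i l m n' α 0) * quarkContraction R j k n.1 m'.1 β else 0)
        + (if n'.2 = m.2 then
          X (.quark k j m' n 0 β) * quarkContraction' R i l n'.1 m.1 α else 0)
      else 0
  | _, _ => 0

/-- The sum over all single contractions, `∑_{g,h} ∂Y/∂g ⟨T g h⟩ ∂Z/∂h`. -/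
noncomputable def contract {cF : ℝ} {G : GaugeData N d} (P : GluonOrdering cF)
    (R : QuarkOrdering G) (Z : Expr N d) : Derivation ℂ (Expr N d) (Expr N d) :=
  mkDerivation ℂ (fun g => mkDerivation ℂ (fun h => pair P R g h) Z)

/-- The time-ordered product `T[Y Z]` of two Wick polynomials at different points, at tree level
(Wick's theorem). -/
noncomputable def tprod {cF : ℝ} {G : GaugeData N d} (P : GluonOrdering cF) (R : QuarkOrdering G)
    (Y Z : Expr N d) : Expr N d :=
  Y * Z + contract P R Z Y

/-- `O_{Y(x_i)}(Z) = T[∂_μ Y^μ(x_i) Z] - ∂_μ T[Y^μ(x_i) Z]` for Wick polynomials `Y^μ` at `x_i`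
and a Wick polynomial `Z` at another point. -/
noncomputable def obs {cF : ℝ} {G : GaugeData N d} (P : GluonOrdering cF) (R : QuarkOrdering G)
    (i : Fin 3) (Y : Fin 4 → Expr N d) (Z : Expr N d) : Expr N d :=
  tprod P R (∑ μ, pd i μ (Y μ)) Z - ∑ μ, pd i μ (tprod P R (Y μ) Z)

/-- A time-ordered product `T[Z(x,x') V(x'')]` of expressions `Z(x,x')` that may contain kernels
in `x - x'` with Wick polynomials `V(x'')`. An undifferentiated factor `δ_{xx'}` can be taken out
of the time-ordering; string-free expressions are time-ordered consistently with the support of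
`δ_{xx'}` and with the exchange of `x` and `x'`. Nothing is prescribed for expressions with
differentiated or string-integrated delta functions beyond this. -/
structure BilocalOrdering {cF : ℝ} {G : GaugeData N d} (P : GluonOrdering cF)
    (R : QuarkOrdering G) where
  T : Expr N d →ₗ[ℂ] Expr N d →ₗ[ℂ] Expr N d
  take_out : ∀ Y ∈ (wick 0 1 : Subalgebra ℂ (Expr N d)),
    ∀ V ∈ (wick 2 0 : Subalgebra ℂ (Expr N d)),
      T (Y * delta 0 1) V - delta 0 1 * tprod P R Y V ∈ supportIdeal
  support : ∀ Z ∈ (supportIdeal : Ideal (Expr N d)), deltaPart Z = Z →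
    ∀ V ∈ (wick 2 0 : Subalgebra ℂ (Expr N d)), T Z V ∈ supportIdeal
  exchange : ∀ Z : Expr N d, deltaPart Z = Z →
    ∀ V ∈ (wick 2 0 : Subalgebra ℂ (Expr N d)),
      relabel (Equiv.swap 0 1) (T Z V) - T (relabel (Equiv.swap 0 1) Z) V ∈ supportIdeal

/-- `O_{Z(x;x')}(V'') = T[∂^x_μ Z^μ(x;x') V''] - ∂^x_μ T[Z^μ(x;x') V'']`. -/
noncomputable def obs2 {cF : ℝ} {G : GaugeData N d} {P : GluonOrdering cF} {R : QuarkOrdering G}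
    (B : BilocalOrdering P R) (Z : Fin 4 → Expr N d) (V : Expr N d) : Expr N d :=
  B.T (∑ μ, pd 0 μ (Z μ)) V - ∑ μ, pd 0 μ (B.T (Z μ) V)

/-! ### The Yang-Mills and QCD interactions -/

/-- Lie-algebra valued fields. -/
noncomputable def w (i : Fin 3) (a : Fin N) : Expr N d := X (.field i .w a 0)
noncomputable def A (i : Fin 3) (μ : Fin 4) (a : Fin N) : Expr N d := X (.field i (.A μ) a 0)
noncomputable def F (i : Fin 3) (μ ν : Fin 4) (a : Fin N) : Expr N d :=
  X (.field i (.F μ ν) a 0)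

/-- `⟨U | V⟩ = U^a V^a`. -/
noncomputable def inn (U V : Fin N → Expr N d) : Expr N d := ∑ a, U a * V a

/-- `i[U, V] = - f_{abc} U^a V^b ξ_c`. -/
noncomputable def brk (G : GaugeData N d) (U V : Fin N → Expr N d) (c : Fin N) : Expr N d :=
  -∑ a, ∑ b, C (G.f a b c : ℂ) * U a * V b

/-- The quark current `j^μ_a = ψ̄ γ^μ π(ξ_a) ψ` (upper index). -/
noncomputable def j (G : GaugeData N d) (i : Fin 3) (μ : Fin 4) (a : Fin N) : Expr N d :=
  ∑ s, ∑ t, ∑ r, ∑ r', C (G.γ μ s t * G.T a r r') * X (.quark i i (s, r) (t, r') 0 0)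

/-- `L_1 = ½ ⟨F^{μν} | i[A_μ, A_ν]⟩ + ⟨A_μ | j^μ⟩`. -/
noncomputable def L1 (G : GaugeData N d) (i : Fin 3) : Expr N d :=
  C (1 / 2 : ℂ) * ∑ μ, ∑ ν, C (sg μ * sg ν) * inn (F i μ ν) (brk G (A i μ) (A i ν))
    + ∑ μ, inn (A i μ) (j G i μ)

/-- `Q_1^μ = ⟨F^{μν} | i[w, A_ν]⟩ + ⟨w | j^μ⟩`. -/
noncomputable def Q1 (G : GaugeData N d) (i : Fin 3) (μ : Fin 4) : Expr N d :=
  ∑ ν, C (sg μ * sg ν) * inn (F i μ ν) (brk G (w i) (A i ν)) + inn (w i) (j G i μ)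

/-- `∂Q_1^μ/∂w = - i[F^{μν}, A_ν] + j^μ`. -/
noncomputable def dQ1dw (G : GaugeData N d) (i : Fin 3) (μ : Fin 4) (a : Fin N) : Expr N d :=
  -(∑ ν, C (sg μ * sg ν) * brk G (F i μ ν) (A i ν) a) + j G i μ a

/-- `L_2 = - ½ (1 + c_F) ⟨i[A^μ, A^ν] | i[A_μ, A_ν]⟩`. -/
noncomputable def L2 (G : GaugeData N d) (cF : ℝ) (i : Fin 3) : Expr N d :=
  C (-(1 / 2) * (1 + (cF : ℂ)))
    * ∑ μ, ∑ ν, C (sg μ * sg ν) * inn (brk G (A i μ) (A i ν)) (brk G (A i μ) (A i ν))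

/-- `w_2(x_i, x_k) = i[w(x_k), A_ν(x_k)] I^ν δ(x_i - x_k)`, with the string at `x_i`. -/
noncomputable def w2 (G : GaugeData N d) (i k : Fin 3) (a : Fin N) : Expr N d :=
  ∑ ν, C (sg ν) * brk G (w k) (A k ν) a * ker .delta i k (II false ν)

/-- `Q_2^μ(x_i; x_k) = - 2 (1 + c_F) ⟨i[A^μ, A^ν] | i[w, A_ν]⟩ δ(x_i - x_k)
+ 2 ⟨∂Q_1^μ/∂w (x_i) | w_2(x_i, x_k)⟩`. -/
noncomputable def Q2 (G : GaugeData N d) (cF : ℝ) (i k : Fin 3) (μ : Fin 4) : Expr N d :=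
  C (-2 * (1 + (cF : ℂ)))
      * (∑ ν, C (sg μ * sg ν) * inn (brk G (A i μ) (A i ν)) (brk G (w i) (A i ν))) * delta i k
    + C 2 * inn (dQ1dw G i μ) (w2 G i k)

/-! ### The third-order obstruction -/

section Third

variable {cF : ℝ} {G : GaugeData N d} {P : GluonOrdering cF} {R : QuarkOrdering G}

/-- `O^{(3)} = 3 𝔖 (O_{Q_1}(L_2') δ_{x'x''} + O_{Q_2(x;x')}(L_1''))`. -/
noncomputable def O3 (B : BilocalOrdering P R) : Expr N d :=
  C 3 * symm3 (obs P R 0 (Q1 G 0) (L2 G cF 1) * delta 1 2 + obs2 B (Q2 G cF 0 1) (L1 G 2))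

/-- The local part `𝔖 [O_{Q_1}(L_2')|_δ δ_{x'x''} + O_{Q_2|_δ}(L_1'')|_δ]`. -/
noncomputable def O3loc (B : BilocalOrdering P R) : Expr N d :=
  symm3 (deltaPart (obs P R 0 (Q1 G 0) (L2 G cF 1)) * delta 1 2
    + deltaPart (obs2 B (fun μ => deltaPart (Q2 G cF 0 1 μ)) (L1 G 2)))

/-- `⟨w_2 | O(∂Q_2/∂w_2, L_1'')⟩`. -/
noncomputable def w2Outer (P : GluonOrdering cF) (R : QuarkOrdering G) : Expr N d :=
  ∑ a, w2 G 0 1 a * obs P R 0 (fun μ => C 2 * dQ1dw G 0 μ a) (L1 G 2)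

/-- `⟨∂Q_2/∂w_2 | O(w_2, L_1'')⟩`: the other part of `O_{Q_2|_{Iδ}}(L_1'')`. -/
noncomputable def w2Inner (B : BilocalOrdering P R) : Expr N d :=
  obs2 B (fun μ => stringPart (Q2 G cF 0 1 μ)) (L1 G 2) - w2Outer P R

/-- `𝔖 [⟨w_2 | O(∂Q_2/∂w_2, L_1'')⟩ + O_{Q_1}(L_2')|_{Iδ} δ_{x'x''}]`. -/
noncomputable def O3w2 (P : GluonOrdering cF) (R : QuarkOrdering G) : Expr N d :=
  symm3 (w2Outer P R + stringPart (obs P R 0 (Q1 G 0) (L2 G cF 1)) * delta 1 2)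

/-- `𝔖 [⟨∂Q_2/∂w_2 | O(w_2, L_1'')⟩ + O_{Q_2|_δ}(L_1'')|_{Iδ}]`. -/
noncomputable def O3remain (B : BilocalOrdering P R) : Expr N d :=
  symm3 (w2Inner B + stringPart (obs2 B (fun μ => deltaPart (Q2 G cF 0 1 μ)) (L1 G 2)))

/-- `Z` is a total derivative, `Z = ∑_l ∂^{x_l}_μ R_l^μ`, of expressions `R_l^μ ∈ S`. -/
def IsDerivativeFrom (G : GaugeData N d) (S : Set (Expr N d)) (Z : Expr N d) : Prop :=
  ∃ r : Fin 3 → Fin 4 → Expr N d, (∀ l μ, r l μ ∈ S) ∧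
    Z - ∑ l, ∑ μ, pd l μ (r l μ) ∈ onShellIdeal G

/-- `O^{(3)} = δ_c L_3 δ_{xx'x''} - 𝔖 ∂_μ Q_3^μ(x; x', x'')`, with `L_3` at `x`. -/
def Resolves (B : BilocalOrdering P R) (L3 : Expr N d) (Q3 : Fin 4 → Expr N d) : Prop :=
  O3 B - (deltaC L3 * delta 0 1 * delta 1 2 - symm3 (∑ μ, pd 0 μ (Q3 μ))) ∈ onShellIdeal G

/-- Expressions without string-free part. -/
def purelyString : Set (Expr N d) := {Z | deltaPart Z = 0}

end Third

end YMQCD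

namespace YMQCD

variable {N d : ℕ}

/-! ### Kernels, derivatives, permutations -/

/-! Claims 2 and 3 are linear bookkeeping on top of claim 1. Splitting `Q2` into its string-free and
string parts gives O^(3) = 3 ((loc) + (a) + (b)) (`O3_eq`), and the identities are stable under
permutations of the points. Since (a) and (b) are symmetric, a representation as ∑_l ∂^{x_l} r_l may
be symmetrized; swapping x_l with x turns it into the symmetrized ∂^x-divergence of `collect r`.
Hence Q_3 = -3 (`collect r` + `collect r'`), and permuting points creates no string-free kernels.

For claim 1, the obstruction of two Wick polynomials at different points is the commutator of the
contraction with ∂_μ, hence a derivation in its first argument (`obs_eq_commutator`), fixed by the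
two-point obstructions. A string-free kernel has non-negative dimension, so the string-free part of
O(A,A) vanishes and those of O(F,A) and O(A,F) are constants times δ; O(F,F) never enters. By
covariance these constants form invariant tensors.

In O_{Q_1}(L_2') the trace of the F-A tensor is κη, so modulo the support relations the obstruction
is iκδ times the infinitesimal gauge rotation of `L2` by w, which vanishes by invariance of the
inner product and Jacobi (`deltaPart_obs_Q1_L2_mem`). For the local part of `Q2` against `L1`, the
A_ν-F_{ρσ} tensor of O_μ is antisymmetric in μν and symmetric under exchange of the pairs μν and ρσ.
The Jacobi identity reduces the variation to ⟨[A_ρ,A_σ] | [w,[A_μ,A_ν]]⟩, which is antisymmetric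
under that exchange (`deltaPart_obs_Q2local_mem`).

It remains to take δ_{xx'} out of the bilocal time-ordered product, which is not prescribed on
∂δ_{xx'}. Symmetrizing in x, x' removes the difficulty: ∂(Yδ) plus its exchange equals (∂Y)δ on the
support of δ (`obs2_add_relabel_mem`). -/

theorem ker_monomial (b : Base) (i j : Fin 3) (m : Op →₀ ℕ) (c : ℂ) :
    (ker b i j (monomial m c) : Expr N d) = C c * X (.kernel b i j m) := by
  have h : (monomial m c : OpAlg) = c • basisMonomials Op ℂ m := by
    simp [smul_monomial]
  rw [h, map_smul, ker, Module.Basis.constr_basis, smul_eq_C_mul]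

theorem delta_eq_X (i j : Fin 3) : (delta i j : Expr N d) = X (.kernel .delta i j 0) := by
  rw [delta, ← C_1, ← monomial_zero', ker_monomial, C_1, one_mul]

/-- A linear map of operators is determined on monomials. -/
theorem opAlg_linear_ext {M : Type*} [AddCommMonoid M] [Module ℂ M] {f g : OpAlg →ₗ[ℂ] M}
    (h : ∀ m, f (monomial m 1) = g (monomial m 1)) : f = g := by
  apply (basisMonomials Op ℂ).ext
  intro m
  simpa using h m

theorem pd_X (l : Fin 3) (μ : Fin 4) (g : Gen N d) :
    pd l μ (X g : Expr N d) = match g with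
    | .field i φ a α => if i = l then X (.field i φ a (α + Finsupp.single μ 1)) else 0
    | .quark i j m n α β =>
        (if i = l then X (.quark i j m n (α + Finsupp.single μ 1) β) else 0)
          + (if j = l then X (.quark i j m n α (β + Finsupp.single μ 1)) else 0)
    | .kernel b i j m =>
        (if i = l then X (.kernel b i j (m + Finsupp.single (Op.d μ) 1)) else 0)
          - (if j = l then X (.kernel b i j (m + Finsupp.single (Op.d μ) 1)) else 0) :=
  mkDerivation_X _ _ _

theorem dd_mul_monomial (μ : Fin 4) (m : Op →₀ ℕ) :
    dd μ * monomial m (1 : ℂ) = monomial (m + Finsupp.single (Op.d μ) 1) 1 := by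
  rw [dd, X, monomial_mul, add_comm, one_mul]

theorem pd_ker (l i j : Fin 3) (μ : Fin 4) (b : Base) (p : OpAlg) :
    pd l μ (ker b i j p : Expr N d)
      = (if i = l then ker b i j (dd μ * p) else 0)
        - (if j = l then ker b i j (dd μ * p) else 0) := by
  let f : OpAlg →ₗ[ℂ] Expr N d := (pd l μ).toLinearMap ∘ₗ ker b i j
  let h : OpAlg →ₗ[ℂ] Expr N d := ker b i j ∘ₗ LinearMap.mulLeft ℂ (dd μ)
  let g : OpAlg →ₗ[ℂ] Expr N d := (if i = l then h else 0) - (if j = l then h else 0)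
  have hfg : f = g := by
    apply opAlg_linear_ext
    intro m
    have hk : h (monomial m 1) = X (.kernel b i j (m + Finsupp.single (Op.d μ) 1)) := by
      simp only [h, LinearMap.comp_apply, LinearMap.mulLeft_apply, dd_mul_monomial,
        ker_monomial, C_1, one_mul]
    have hf : f (monomial m 1) = pd l μ (X (.kernel b i j m) : Expr N d) := by
      simp only [f, LinearMap.comp_apply, ker_monomial, C_1, one_mul]
      rfl
    rw [hf, pd_X]
    simp only [g, LinearMap.sub_apply, ← hk]
    split_ifs <;> simp
  have := LinearMap.congr_fun hfg p
  change f p = _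
  rw [this]
  simp only [g, LinearMap.sub_apply]
  split_ifs <;> simp [h]

theorem relabel_X (σ : Equiv.Perm (Fin 3)) (g : Gen N d) :
    relabel σ (X g : Expr N d) = X (g.map σ) := rename_X _ _

theorem relabel_ker (σ : Equiv.Perm (Fin 3)) (b : Base) (i j : Fin 3) (p : OpAlg) :
    relabel σ (ker b i j p : Expr N d) = ker b (σ i) (σ j) p := by
  have : (relabel σ).toLinearMap ∘ₗ (ker b i j : OpAlg →ₗ[ℂ] Expr N d) = ker b (σ i) (σ j) := by
    apply opAlg_linear_ext
    intro m
    simp only [LinearMap.comp_apply, ker_monomial, C_1, one_mul, AlgHom.toLinearMap_apply,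
      relabel_X, Gen.map]
  exact LinearMap.congr_fun this p

theorem relabel_delta (σ : Equiv.Perm (Fin 3)) (i j : Fin 3) :
    relabel σ (delta i j : Expr N d) = delta (σ i) (σ j) := relabel_ker _ _ _ _ _

/-- An algebra homomorphism intertwines two derivations if it does so on the generators. -/
theorem algHom_intertwines {ι : Type*} (φ : MvPolynomial ι ℂ →ₐ[ℂ] MvPolynomial ι ℂ)
    (D D' : Derivation ℂ (MvPolynomial ι ℂ) (MvPolynomial ι ℂ))
    (h : ∀ g, φ (D (X g)) = D' (φ (X g))) (Z : MvPolynomial ι ℂ) : φ (D Z) = D' (φ Z) := by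
  induction Z using MvPolynomial.induction_on with
  | C a =>
    have h1 : D (C a) = 0 := by rw [← algebraMap_eq]; exact D.map_algebraMap a
    have h2 : D' (φ (C a)) = 0 := by
      rw [← algebraMap_eq, φ.commutes]; exact D'.map_algebraMap a
    rw [h1, h2, map_zero]
  | add p q hp hq => simp only [map_add, hp, hq]
  | mul_X p g hp =>
    have h1 : D (p * X g) = p * D (X g) + X g * D p := D.leibniz _ _
    have h2 : D' (φ p * φ (X g)) = φ p * D' (φ (X g)) + φ (X g) * D' (φ p) := D'.leibniz _ _
    rw [h1, map_add, map_mul, map_mul, hp, h, map_mul, h2]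

theorem relabel_pd (σ : Equiv.Perm (Fin 3)) (l : Fin 3) (μ : Fin 4) (Z : Expr N d) :
    relabel σ (pd l μ Z) = pd (σ l) μ (relabel σ Z) := by
  apply algHom_intertwines
  intro g
  rw [relabel_X, pd_X, pd_X]
  cases g <;> simp only [Gen.map, EmbeddingLike.apply_eq_iff_eq] <;> split_ifs <;>
    simp [relabel_X, Gen.map]

theorem relabel_relabel (σ τ : Equiv.Perm (Fin 3)) (Z : Expr N d) :
    relabel σ (relabel τ Z) = relabel (σ * τ) Z := by
  have : ((relabel σ).comp (relabel τ) : Expr N d →ₐ[ℂ] Expr N d) = relabel (σ * τ) := by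
    apply MvPolynomial.algHom_ext
    intro g
    rw [AlgHom.comp_apply, relabel_X, relabel_X, relabel_X]
    cases g <;> rfl
  exact DFunLike.congr_fun this Z

/-! ### Symmetrization -/

theorem symm3_add (Y Z : Expr N d) : symm3 (Y + Z) = symm3 Y + symm3 Z := by
  simp only [symm3, map_add, Finset.sum_add_distrib, mul_add]

theorem symm3_C_mul (c : ℂ) (Z : Expr N d) : symm3 (C c * Z) = C c * symm3 Z := by
  have h (σ : Equiv.Perm (Fin 3)) : relabel σ (C c : Expr N d) = C c := (relabel σ).commutes c
  simp only [symm3, map_mul, h, ← Finset.mul_sum]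
  ring

theorem symm3_sum {ι : Type*} (s : Finset ι) (Z : ι → Expr N d) :
    symm3 (∑ i ∈ s, Z i) = ∑ i ∈ s, symm3 (Z i) := by
  simp only [symm3, map_sum]
  rw [Finset.sum_comm, Finset.mul_sum]

theorem symm3_relabel (τ : Equiv.Perm (Fin 3)) (Z : Expr N d) :
    symm3 (relabel τ Z) = symm3 Z := by
  have h : ∑ σ, relabel (σ * τ) Z = ∑ σ, relabel σ Z :=
    Fintype.sum_equiv (Equiv.mulRight τ) _ _ (fun _ => rfl)
  simp only [symm3, relabel_relabel, h]

theorem relabel_symm3 (τ : Equiv.Perm (Fin 3)) (Z : Expr N d) :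
    relabel τ (symm3 Z) = symm3 Z := by
  have h : relabel τ (C (1 / 6 : ℂ) : Expr N d) = C (1 / 6) := (relabel τ).commutes _
  have h' : ∑ σ, relabel (τ * σ) Z = ∑ σ, relabel σ Z :=
    Fintype.sum_equiv (Equiv.mulLeft τ) _ _ (fun _ => rfl)
  simp only [symm3, map_mul, map_sum, relabel_relabel, h, h']

theorem symm3_of_invariant {Z : Expr N d} (h : ∀ σ, relabel σ Z = Z) : symm3 Z = Z := by
  simp only [symm3, h, Finset.sum_const, Finset.card_univ, Fintype.card_perm, Fintype.card_fin]
  rw [nsmul_eq_mul, ← mul_assoc, ← C_eq_coe_nat, ← C_mul]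
  norm_num [Nat.factorial]

theorem symm3_symm3 (Z : Expr N d) : symm3 (symm3 Z) = symm3 Z :=
  symm3_of_invariant (fun σ => relabel_symm3 σ Z)

/-! ### The string-free part -/

theorem deltaPart_field (i : Fin 3) (φ : Species) (a : Fin N) (α : Multi) :
    deltaPart (X (.field i φ a α) : Expr N d) = X (.field i φ a α) := aeval_X _ _

theorem deltaPart_quark (i j : Fin 3) (m n : Fin 4 × Fin d) (α β : Multi) :
    deltaPart (X (.quark i j m n α β) : Expr N d) = X (.quark i j m n α β) := aeval_X _ _

/-- The operator monomial contains derivatives only. -/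
def StringFree (m : Op →₀ ℕ) : Prop := ∀ o ∈ m.support, ∃ μ, o = Op.d μ

theorem deltaPart_kernel (b : Base) (i j : Fin 3) {m : Op →₀ ℕ} (h : StringFree m) :
    deltaPart (X (.kernel b i j m) : Expr N d) = X (.kernel b i j m) :=
  (aeval_X _ _).trans (if_pos h)

theorem deltaPart_kernel_string (b : Base) (i j : Fin 3) {m : Op →₀ ℕ} (h : ¬StringFree m) :
    deltaPart (X (.kernel b i j m) : Expr N d) = 0 :=
  (aeval_X _ _).trans (if_neg h)

theorem stringFree_zero : StringFree 0 := by simp [StringFree]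

theorem stringFree_add_d (m : Op →₀ ℕ) (μ : Fin 4) :
    StringFree (m + Finsupp.single (Op.d μ) 1) ↔ StringFree m := by
  constructor
  · intro h o ho
    apply h
    simp only [Finsupp.mem_support_iff, Finsupp.add_apply] at ho ⊢
    omega
  · intro h o ho
    rw [Finsupp.mem_support_iff, Finsupp.add_apply] at ho
    by_cases hm : m o = 0
    · refine ⟨μ, ?_⟩
      by_contra hne
      rw [hm, Finsupp.single_eq_of_ne hne] at ho
      exact ho rfl
    · exact h o (Finsupp.mem_support_iff.2 hm)

theorem deltaPart_C (c : ℂ) : deltaPart (C c : Expr N d) = C c := deltaPart.commutes c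

theorem deltaPart_delta (i j : Fin 3) : deltaPart (delta i j : Expr N d) = delta i j := by
  rw [delta_eq_X, deltaPart_kernel _ _ _ stringFree_zero]

/-- A derivative only multiplies a kernel monomial by some `Op.d μ`, so it neither creates nor
removes strings. -/
theorem deltaPart_pd (l : Fin 3) (μ : Fin 4) (Z : Expr N d) :
    deltaPart (pd l μ Z) = pd l μ (deltaPart Z) := by
  apply algHom_intertwines
  intro g
  cases g with
  | field i φ a α =>
    rw [deltaPart_field, pd_X]
    dsimp only
    split_ifs <;> simp [deltaPart_field]
  | quark i j m n α β =>
    rw [deltaPart_quark, pd_X]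
    dsimp only
    split_ifs <;> simp [deltaPart_quark]
  | kernel b i j m =>
    by_cases h : StringFree m
    · have h' := deltaPart_kernel (N := N) (d := d) b i j ((stringFree_add_d m μ).2 h)
      rw [deltaPart_kernel _ _ _ h, pd_X]
      dsimp only
      split_ifs <;> simp only [map_sub, map_zero, h']
    · have h' := deltaPart_kernel_string (N := N) (d := d) b i j
        (fun hm => h ((stringFree_add_d m μ).1 hm))
      rw [deltaPart_kernel_string _ _ _ h, map_zero, pd_X]
      dsimp only
      split_ifs <;> simp only [map_sub, map_zero, h', sub_zero]

theorem relabel_deltaPart (σ : Equiv.Perm (Fin 3)) (Z : Expr N d) :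
    relabel σ (deltaPart Z) = deltaPart (relabel σ Z) := by
  have : ((relabel σ).comp deltaPart : Expr N d →ₐ[ℂ] Expr N d) = deltaPart.comp (relabel σ) := by
    apply MvPolynomial.algHom_ext
    intro g
    rw [AlgHom.comp_apply, AlgHom.comp_apply, relabel_X]
    cases g with
    | field i φ a α => rw [deltaPart_field, relabel_X, Gen.map, deltaPart_field]
    | quark i j m n α β => rw [deltaPart_quark, relabel_X, Gen.map, deltaPart_quark]
    | kernel b i j m =>
      by_cases h : StringFree m
      · rw [deltaPart_kernel _ _ _ h, relabel_X, Gen.map, deltaPart_kernel _ _ _ h]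
      · rw [deltaPart_kernel_string _ _ _ h, map_zero, Gen.map, deltaPart_kernel_string _ _ _ h]
  exact DFunLike.congr_fun this Z

/-! ### Differential ideals -/

theorem subset_diffIdeal (S : Set (Expr N d)) : S ⊆ diffIdeal S := by
  intro Z hZ
  rw [diffIdeal, SetLike.mem_coe, Submodule.mem_sInf]
  exact fun J hJ => hJ.1 hZ

theorem pd_mem_diffIdeal {S : Set (Expr N d)} (l : Fin 3) (μ : Fin 4) {Z : Expr N d}
    (hZ : Z ∈ diffIdeal S) : pd l μ Z ∈ diffIdeal S := by
  rw [diffIdeal, Submodule.mem_sInf] at hZ ⊢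
  exact fun J hJ => hJ.2 l μ Z (hZ J hJ)

theorem diffIdeal_le {S : Set (Expr N d)} {J : Ideal (Expr N d)} (h : S ⊆ J)
    (h' : ∀ l μ, ∀ Z ∈ J, pd l μ Z ∈ J) : diffIdeal S ≤ J :=
  sInf_le ⟨h, h'⟩

theorem diffIdeal_mono {S S' : Set (Expr N d)} (h : S ⊆ S') : diffIdeal S ≤ diffIdeal S' :=
  diffIdeal_le (h.trans (subset_diffIdeal S')) (fun l μ _ hZ => pd_mem_diffIdeal l μ hZ)

/-- A homomorphism that permutes the derivatives maps differential ideals into each other. -/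
theorem map_mem_diffIdeal {S S' : Set (Expr N d)} (φ : Expr N d →ₐ[ℂ] Expr N d)
    (σ : Fin 3 → Fin 3) (hφ : ∀ l μ Z, φ (pd l μ Z) = pd (σ l) μ (φ Z))
    (h : ∀ Z ∈ S, φ Z ∈ diffIdeal S') {Z : Expr N d} (hZ : Z ∈ diffIdeal S) :
    φ Z ∈ diffIdeal S' := by
  have : diffIdeal S ≤ (diffIdeal S').comap φ := by
    apply diffIdeal_le
    · exact fun Z hZ => h Z hZ
    · intro l μ Z hZ
      rw [Ideal.mem_comap] at hZ ⊢
      rw [hφ]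
      exact pd_mem_diffIdeal _ _ hZ
  exact this hZ

theorem supportIdeal_le_onShellIdeal (G : GaugeData N d) :
    (supportIdeal : Ideal (Expr N d)) ≤ onShellIdeal G :=
  diffIdeal_mono Set.subset_union_left

theorem Gen.map_map (f g : Fin 3 → Fin 3) (h : Gen N d) : (h.map g).map f = h.map (f ∘ g) := by
  cases h <;> rfl

theorem notLinking_map (σ : Equiv.Perm (Fin 3)) (i j : Fin 3) (g : Gen N d) :
    (g.map σ).NotLinking (σ i) (σ j) ↔ g.NotLinking i j := by
  cases g <;> simp [Gen.map, Gen.NotLinking]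

theorem update_comp_perm (σ : Equiv.Perm (Fin 3)) (i j : Fin 3) :
    (σ : Fin 3 → Fin 3) ∘ Function.update id i j = Function.update id (σ i) (σ j) ∘ σ := by
  funext k
  by_cases h : k = i
  · subst h; simp
  · have h' : σ k ≠ σ i := fun hk => h (σ.injective hk)
    simp [Function.update_of_ne h, Function.update_of_ne h']

theorem relabel_mem_supportRelations (σ : Equiv.Perm (Fin 3)) {Z : Expr N d}
    (hZ : Z ∈ supportRelations) : relabel σ Z ∈ supportRelations := by
  rcases hZ with ⟨i, j, g, hij, hg, rfl⟩ | ⟨b, i, j, p, hij, rfl⟩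
  · refine Or.inl ⟨σ i, σ j, g.map σ, fun h => hij (σ.injective h),
      (notLinking_map σ i j g).2 hg, ?_⟩
    rw [map_mul, map_sub, relabel_X, relabel_X, relabel_delta, Gen.map_map, Gen.map_map,
      update_comp_perm]
  · refine Or.inr ⟨b, σ i, σ j, p, fun h => hij (σ.injective h), ?_⟩
    rw [map_sub, relabel_ker, relabel_ker]

theorem relabel_C (σ : Equiv.Perm (Fin 3)) (c : ℂ) : relabel σ (C c : Expr N d) = C c :=
  (relabel σ).commutes c

theorem relabel_mem_fieldRelations (G : GaugeData N d) (σ : Equiv.Perm (Fin 3)) {Z : Expr N d}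
    (hZ : Z ∈ fieldRelations G) : relabel σ Z ∈ fieldRelations G := by
  rcases hZ with ⟨i, a, μ, ν, rfl⟩ | ⟨i, a, ν, rfl⟩ | ⟨i, a, μ, ν, rfl⟩ | ⟨i, a, rfl⟩ | ⟨i, a, rfl⟩ |
    ⟨i, j, m, s, r, α, β, rfl⟩ | ⟨i, j, n, s, r, α, β, rfl⟩ |
    ⟨i, j, k, l, m, n, m', n', α, β, α', β', rfl⟩ | ⟨b, i, j, p, hp, rfl⟩ | ⟨i, j, p, hij, rfl⟩
  · refine Or.inl ⟨σ i, a, μ, ν, ?_⟩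
    simp only [map_add, relabel_X, Gen.map]
  · refine Or.inr (Or.inl ⟨σ i, a, ν, ?_⟩)
    simp only [map_sum, map_mul, relabel_C, relabel_pd, relabel_X, Gen.map]
  · refine Or.inr (Or.inr (Or.inl ⟨σ i, a, μ, ν, ?_⟩))
    simp only [map_sub, relabel_pd, relabel_X, Gen.map]
  · refine Or.inr (Or.inr (Or.inr (Or.inl ⟨σ i, a, ?_⟩)))
    simp only [map_sum, map_mul, relabel_C, relabel_pd, relabel_X, Gen.map]
  · refine Or.inr (Or.inr (Or.inr (Or.inr (Or.inl ⟨σ i, a, ?_⟩))))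
    simp only [map_sum, map_mul, relabel_C, relabel_pd, relabel_X, Gen.map]
  · refine Or.inr (Or.inr (Or.inr (Or.inr (Or.inr (Or.inl ⟨σ i, σ j, m, s, r, α, β, ?_⟩)))))
    simp only [map_sum, map_mul, relabel_C, relabel_X, Gen.map]
  · refine Or.inr (Or.inr (Or.inr (Or.inr (Or.inr (Or.inr (Or.inl
      ⟨σ i, σ j, n, s, r, α, β, ?_⟩))))))
    simp only [map_sum, map_mul, relabel_C, relabel_X, Gen.map]
  · refine Or.inr (Or.inr (Or.inr (Or.inr (Or.inr (Or.inr (Or.inr (Or.inl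
      ⟨σ i, σ j, σ k, σ l, m, n, m', n', α, β, α', β', ?_⟩)))))))
    simp only [map_add, map_mul, relabel_X, Gen.map]
  · refine Or.inr (Or.inr (Or.inr (Or.inr (Or.inr (Or.inr (Or.inr (Or.inr (Or.inl
      ⟨b, σ i, σ j, p, hp, ?_⟩))))))))
    rw [relabel_ker]
  · refine Or.inr (Or.inr (Or.inr (Or.inr (Or.inr (Or.inr (Or.inr (Or.inr (Or.inr
      ⟨σ i, σ j, p, fun h => hij (σ.injective h), ?_⟩))))))))
    rw [map_add, map_mul (relabel σ), relabel_C, relabel_ker, relabel_ker]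

theorem relabel_mem_supportIdeal (σ : Equiv.Perm (Fin 3)) {Z : Expr N d}
    (hZ : Z ∈ (supportIdeal : Ideal (Expr N d))) : relabel σ Z ∈ supportIdeal :=
  map_mem_diffIdeal (relabel σ) σ (relabel_pd σ)
    (fun _ hZ => subset_diffIdeal _ (relabel_mem_supportRelations σ hZ)) hZ

theorem relabel_mem_onShellIdeal (G : GaugeData N d) (σ : Equiv.Perm (Fin 3)) {Z : Expr N d}
    (hZ : Z ∈ onShellIdeal G) : relabel σ Z ∈ onShellIdeal G :=
  map_mem_diffIdeal (relabel σ) σ (relabel_pd σ)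
    (fun _ hZ => subset_diffIdeal _ (hZ.imp (relabel_mem_supportRelations σ)
      (relabel_mem_fieldRelations G σ))) hZ

theorem symm3_mem_of_relabel_mem {J : Ideal (Expr N d)} {Z : Expr N d}
    (h : ∀ σ, relabel σ Z ∈ J) : symm3 Z ∈ J :=
  J.mul_mem_left _ (J.sum_mem fun σ _ => h σ)

/-! ### The string-free part of the support relations -/

theorem opFlip_d (μ : Fin 4) : opFlip (X (Op.d μ)) = -dd μ := aeval_X _ _

theorem opFlip_I (s : Bool) (μ : Fin 4) : opFlip (X (Op.I s μ)) = II (!s) μ := aeval_X _ _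

theorem opFlip_K (s : Bool) (μ ν : Fin 4) : opFlip (X (Op.K s μ ν)) = KK (!s) μ ν := aeval_X _ _

/-- Flipping changes signs of derivatives and moves strings to the other endpoint. Since monomials
go to multiples of monomials, dropping string kernels is compatible with the flip relations. -/
theorem opFlip_monomial (m : Op →₀ ℕ) :
    ∃ (c : ℂ) (m' : Op →₀ ℕ), opFlip (monomial m 1) = monomial m' c ∧
      (StringFree m' ↔ StringFree m) := by
  induction m using Finsupp.induction_linear with
  | zero => exact ⟨1, 0, by rw [monomial_zero', C_1, map_one], Iff.rfl⟩
  | add m n hm hn =>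
    obtain ⟨c, m', h, hm'⟩ := hm
    obtain ⟨e, n', h', hn'⟩ := hn
    have key (m n : Op →₀ ℕ) : StringFree (m + n) ↔ StringFree m ∧ StringFree n := by
      simp only [StringFree, Finsupp.mem_support_iff, Finsupp.add_apply, ne_eq,
        Nat.add_eq_zero_iff, not_and_or, or_imp, forall_and]
    refine ⟨c * e, m' + n', ?_, ?_⟩
    · rw [← monomial_mul, ← h, ← h', ← map_mul, monomial_mul, one_mul]
    · rw [key, key, hm', hn']
  | single o k =>
    have key (o : Op) (k : ℕ) (hk : k ≠ 0) :
        StringFree (Finsupp.single o k) ↔ ∃ μ, o = Op.d μ := by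
      simp [StringFree, Finsupp.support_single, hk]
    have hX : (monomial (Finsupp.single o k) 1 : OpAlg) = X o ^ k := by
      rw [X_pow_eq_monomial]
    -- At exponent zero the monomial is 1 whatever the operator; otherwise the support is exactly
    -- `{o}` and `key` applies.
    rcases Nat.eq_zero_or_pos k with rfl | hk
    · exact ⟨1, 0, by simp, by simp⟩
    cases o with
    | d μ =>
      refine ⟨(-1) ^ k, Finsupp.single (Op.d μ) k, ?_, Iff.rfl⟩
      rw [hX, map_pow, opFlip_d, neg_pow, dd, X_pow_eq_monomial]
      rw [← C_1, ← C_neg, ← C_pow, C_mul_monomial, mul_one]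
    | I s μ =>
      refine ⟨1, Finsupp.single (Op.I (!s) μ) k, ?_, ?_⟩
      · rw [hX, map_pow, opFlip_I, II, X_pow_eq_monomial]
      · rw [key _ _ hk.ne', key _ _ hk.ne']; simp
    | K s μ ν =>
      refine ⟨1, Finsupp.single (Op.K (!s) μ ν) k, ?_, ?_⟩
      · rw [hX, map_pow, opFlip_K, KK, X_pow_eq_monomial]
      · rw [key _ _ hk.ne', key _ _ hk.ne']; simp

theorem ker_flip_mem (b : Base) {i j : Fin 3} (hij : i ≠ j) (p : OpAlg) :
    (ker b j i p - ker b i j (opFlip p) : Expr N d) ∈ supportIdeal :=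
  subset_diffIdeal _ (Or.inr ⟨b, i, j, p, hij, rfl⟩)

theorem deltaPart_ker_flip_mem (b : Base) {i j : Fin 3} (hij : i ≠ j) (p : OpAlg) :
    deltaPart (ker b j i p - ker b i j (opFlip p) : Expr N d) ∈ supportIdeal := by
  induction p using MvPolynomial.induction_on' with
  | monomial m a =>
    obtain ⟨c, m', h, hm⟩ := opFlip_monomial m
    have h0 : (monomial m a : OpAlg) = a • monomial m 1 := by
      rw [smul_monomial, smul_eq_mul, mul_one]
    have h1 : (ker b j i (monomial m a) - ker b i j (opFlip (monomial m a)) : Expr N d)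
        = C a * (X (.kernel b j i m) - C c * X (.kernel b i j m')) := by
      rw [h0, map_smul, map_smul, map_smul, h, ker_monomial, ker_monomial, smul_eq_C_mul,
        smul_eq_C_mul, C_1, one_mul, mul_sub]
    have h2 := ker_flip_mem (N := N) (d := d) b hij (monomial m a)
    rw [h1] at h2 ⊢
    by_cases hs : StringFree m
    · simpa only [map_mul, map_sub, deltaPart_C, deltaPart_kernel _ _ _ hs,
        deltaPart_kernel _ _ _ (hm.2 hs)] using h2
    · simp only [map_mul, map_sub, deltaPart_C, deltaPart_kernel_string _ _ _ hs,
        deltaPart_kernel_string _ _ _ (fun h => hs (hm.1 h)), mul_zero, sub_zero]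
      exact zero_mem _
  | add p q hp hq =>
    have : (ker b j i (p + q) - ker b i j (opFlip (p + q)) : Expr N d)
        = (ker b j i p - ker b i j (opFlip p)) + (ker b j i q - ker b i j (opFlip q)) := by
      simp only [map_add]; ring
    rw [this, map_add]
    exact add_mem hp hq

/-- Every generating relation is either preserved or sent to zero: moving a point of a kernel does
not alter its operator monomial, and flipping preserves string-freeness. -/
theorem deltaPart_mem_supportIdeal {Z : Expr N d}
    (hZ : Z ∈ (supportIdeal : Ideal (Expr N d))) : deltaPart Z ∈ supportIdeal := by
  refine map_mem_diffIdeal deltaPart id deltaPart_pd ?_ hZ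
  rintro Z (⟨i, j, g, hij, hg, rfl⟩ | ⟨b, i, j, p, hij, rfl⟩) <;> rw [← supportIdeal]
  · have h : (X g - X (g.map (Function.update id i j))) * delta i j
        ∈ (supportIdeal : Ideal (Expr N d)) := subset_diffIdeal _ (Or.inl ⟨i, j, g, hij, hg, rfl⟩)
    cases g with
    | field k φ a α =>
      simpa only [map_mul, map_sub, Gen.map, deltaPart_field, deltaPart_delta] using h
    | quark k l m n α β =>
      simpa only [map_mul, map_sub, Gen.map, deltaPart_quark, deltaPart_delta] using h
    | kernel b k l m =>
      by_cases hs : StringFree m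
      · simpa only [map_mul, map_sub, Gen.map, deltaPart_kernel _ _ _ hs, deltaPart_delta] using h
      · simp only [map_mul, map_sub, Gen.map, deltaPart_kernel_string _ _ _ hs, sub_zero, zero_mul]
        exact zero_mem _
  · exact deltaPart_ker_flip_mem b hij p

/-! ### Moving points on the support of the delta function -/

theorem delta_comm_mem {i j : Fin 3} (hij : i ≠ j) :
    (delta j i - delta i j : Expr N d) ∈ supportIdeal := by
  have h := ker_flip_mem (N := N) (d := d) .delta hij 1
  rwa [map_one opFlip] at h

/-- On the support of `δ(x_i - x_j)` the point `x_i` may be replaced by `x_j`. -/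
theorem sub_rename_mul_delta_mem {i j : Fin 3} (hij : i ≠ j) {Z : Expr N d}
    (hZ : Z ∈ supported ℂ {g : Gen N d | g.NotLinking i j}) :
    (Z - rename (Gen.map (Function.update id i j)) Z) * delta i j
      ∈ (supportIdeal : Ideal (Expr N d)) := by
  rw [supported] at hZ
  induction hZ using Algebra.adjoin_induction with
  | mem Z hZ =>
    obtain ⟨g, hg, rfl⟩ := hZ
    rw [rename_X]
    exact subset_diffIdeal _ (Or.inl ⟨i, j, g, hij, hg, rfl⟩)
  | algebraMap c => rw [AlgHom.commutes, sub_self, zero_mul]; exact zero_mem _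
  | add Y Z _ _ hY hZ =>
    have := add_mem hY hZ
    rwa [← add_mul, ← add_sub_add_comm, ← map_add] at this
  | mul Y Z _ _ hY hZ =>
    have h1 := Ideal.mul_mem_left supportIdeal Z hY
    have h2 := Ideal.mul_mem_left supportIdeal
      (rename (Gen.map (Function.update id i j)) Y) hZ
    convert add_mem h1 h2 using 1
    rw [map_mul]
    ring

/-! ### Resolution of the obstruction by a symmetrized derivative -/

section Resolution

variable {cF : ℝ} {G : GaugeData N d} {P : GluonOrdering cF} {R : QuarkOrdering G}

theorem deltaPart_add_stringPart (Z : Expr N d) : deltaPart Z + stringPart Z = Z := by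
  rw [stringPart, add_sub_cancel]

theorem obs2_add (B : BilocalOrdering P R) (Y Z : Fin 4 → Expr N d) (V : Expr N d) :
    obs2 B (fun μ => Y μ + Z μ) V = obs2 B Y V + obs2 B Z V := by
  simp only [obs2, map_add, Finset.sum_add_distrib, LinearMap.add_apply]
  ring

/-- `w2Outer` is added in (a) and, through `w2Inner`, subtracted in (b), so only linearity of the
obstruction in `Q2` is needed. -/
theorem O3_eq (B : BilocalOrdering P R) :
    O3 B = C 3 * (O3loc B + O3w2 P R + O3remain B) := by
  rw [O3, O3loc, O3w2, O3remain, ← symm3_add, ← symm3_add, w2Inner]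
  have h : obs2 B (Q2 G cF 0 1) (L1 G 2) = obs2 B (fun μ => deltaPart (Q2 G cF 0 1 μ)) (L1 G 2)
      + obs2 B (fun μ => stringPart (Q2 G cF 0 1 μ)) (L1 G 2) := by
    rw [← obs2_add]
    simp only [deltaPart_add_stringPart]
  have h1 := deltaPart_add_stringPart (obs P R 0 (Q1 G 0) (L2 G cF 1))
  have h2 := deltaPart_add_stringPart
    (obs2 B (fun μ => deltaPart (Q2 G cF 0 1 μ)) (L1 G 2))
  rw [h]
  generalize obs2 B (fun μ => deltaPart (Q2 G cF 0 1 μ)) (L1 G 2) = S at h2 ⊢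
  generalize obs2 B (fun μ => stringPart (Q2 G cF 0 1 μ)) (L1 G 2) = S'
  generalize obs P R 0 (Q1 G 0) (L2 G cF 1) = U at h1 ⊢
  refine congrArg (fun Z => C 3 * symm3 Z) ?_
  nth_rw 1 [← h1, ← h2]
  ring

/-- The density at `x` with the same symmetrized divergence as `r`. -/
noncomputable def collect (r : Fin 3 → Fin 4 → Expr N d) (μ : Fin 4) : Expr N d :=
  ∑ l, relabel (Equiv.swap 0 l) (r l μ)

/-- Symmetrization is blind to relabelling, and the swap of x_l with x turns ∂^{x_l} into ∂^x. -/
theorem symm3_divergence (r : Fin 3 → Fin 4 → Expr N d) :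
    symm3 (∑ l, ∑ μ, pd l μ (r l μ)) = symm3 (∑ μ, pd 0 μ (collect r μ)) := by
  rw [Finset.sum_comm]
  simp only [symm3_sum, collect, map_sum]
  refine Finset.sum_congr rfl fun μ _ => Finset.sum_congr rfl fun l _ => ?_
  rw [← symm3_relabel (Equiv.swap 0 l), relabel_pd, Equiv.swap_apply_right]

theorem sub_symm3_divergence_mem {Z : Expr N d} (hZ : symm3 Z = Z)
    {r : Fin 3 → Fin 4 → Expr N d}
    (h : Z - ∑ l, ∑ μ, pd l μ (r l μ) ∈ onShellIdeal G) :
    Z - symm3 (∑ μ, pd 0 μ (collect r μ)) ∈ onShellIdeal G := by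
  have h1 := symm3_mem_of_relabel_mem (fun σ => relabel_mem_onShellIdeal G σ h)
  rw [sub_eq_add_neg, ← neg_one_mul, ← C_1, ← C_neg, symm3_add, symm3_C_mul, symm3_divergence,
    hZ] at h1
  rwa [C_neg, C_1, neg_one_mul, ← sub_eq_add_neg] at h1

theorem deltaPart_collect {r : Fin 3 → Fin 4 → Expr N d} (h : ∀ l μ, deltaPart (r l μ) = 0)
    (μ : Fin 4) : deltaPart (collect r μ) = 0 := by
  simp only [collect, map_sum, ← relabel_deltaPart, h, map_zero, Finset.sum_const_zero]

/-- If the local part vanishes, and the string-delta parts are total derivatives of `r` and `r'`,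
then the obstruction is resolved without `L_3`. -/
theorem resolves_of_derivatives {B : BilocalOrdering P R}
    (hloc : O3loc B ∈ (supportIdeal : Ideal (Expr N d))) {r r' : Fin 3 → Fin 4 → Expr N d}
    (h : O3w2 P R - ∑ l, ∑ μ, pd l μ (r l μ) ∈ onShellIdeal G)
    (h' : O3remain B - ∑ l, ∑ μ, pd l μ (r' l μ) ∈ onShellIdeal G) :
    Resolves B 0 (fun μ => C (-3) * (collect r μ + collect r' μ)) := by
  have h0 := supportIdeal_le_onShellIdeal G hloc
  have h1 := sub_symm3_divergence_mem (Z := O3w2 P R) (symm3_symm3 _) h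
  have h2 := sub_symm3_divergence_mem (Z := O3remain B) (symm3_symm3 _) h'
  have h3 := Ideal.mul_mem_left _ (C 3) (add_mem (add_mem h0 h1) h2)
  -- The factor -3 in the density combines the 3 in `O3` with the minus sign in front of 𝔖 ∂Q_3.
  rw [Resolves, O3_eq]
  convert h3 using 1
  have hC (μ : Fin 4) (Z : Expr N d) : pd 0 μ (C (-3) * Z) = C (-3) * pd 0 μ Z := by
    rw [← smul_eq_C_mul, ← smul_eq_C_mul, Derivation.map_smul]
  simp only [hC, map_add, ← Finset.mul_sum, symm3_C_mul, Finset.sum_add_distrib, symm3_add,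
    map_zero, zero_mul]
  rw [C_neg]
  ring

end Resolution

/-! ### Points of an expression -/

/-- All points of the generator are among `x_i`, `x_k`, and its kernel is from `x_i` to `x_k`. -/
def Gen.Between (i k : Fin 3) : Gen N d → Prop
  | .field j _ _ _ => j = i ∨ j = k
  | .quark j l _ _ _ _ => (j = i ∨ j = k) ∧ (l = i ∨ l = k)
  | .kernel _ j l _ => j = i ∧ l = k

/-- Expressions at the points `x_i`, `x_k`. -/
noncomputable def between (i k : Fin 3) : Subalgebra ℂ (Expr N d) :=
  supported ℂ {g | g.Between i k}

theorem C_mem (S : Subalgebra ℂ (Expr N d)) (c : ℂ) : C c ∈ S := Subalgebra.algebraMap_mem _ c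

theorem supported_induction {ι : Type*} {s : Set ι} {p : MvPolynomial ι ℂ → Prop}
    (hX : ∀ g ∈ s, p (X g)) (hC : ∀ c, p (C c)) (hadd : ∀ Y Z, p Y → p Z → p (Y + Z))
    (hmul : ∀ Y Z, p Y → p Z → p (Y * Z)) {Z : MvPolynomial ι ℂ} (hZ : Z ∈ supported ℂ s) :
    p Z := by
  rw [supported] at hZ
  induction hZ using Algebra.adjoin_induction with
  | mem Z hZ => obtain ⟨g, hg, rfl⟩ := hZ; exact hX g hg
  | algebraMap c => exact hC c
  | add Y Z _ _ hY hZ => exact hadd Y Z hY hZ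
  | mul Y Z _ _ hY hZ => exact hmul Y Z hY hZ

theorem derivation_C {ι : Type*} (D : Derivation ℂ (MvPolynomial ι ℂ) (MvPolynomial ι ℂ))
    (c : ℂ) : D (C c) = 0 := by
  rw [← algebraMap_eq]; exact D.map_algebraMap c

theorem derivation_mul {ι : Type*} (D : Derivation ℂ (MvPolynomial ι ℂ) (MvPolynomial ι ℂ))
    (Y Z : MvPolynomial ι ℂ) : D (Y * Z) = Y * D Z + Z * D Y := D.leibniz Y Z

theorem derivation_eq_zero {ι : Type*} {s : Set ι}
    {D : Derivation ℂ (MvPolynomial ι ℂ) (MvPolynomial ι ℂ)} (h : ∀ g ∈ s, D (X g) = 0)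
    {Z : MvPolynomial ι ℂ} (hZ : Z ∈ supported ℂ s) : D Z = 0 := by
  refine supported_induction (p := fun Z => D Z = 0) h (derivation_C D)
    (fun Y Z hY hZ => ?_) (fun Y Z hY hZ => ?_) hZ
  · rw [map_add, hY, hZ, add_zero]
  · rw [derivation_mul, hY, hZ, mul_zero, mul_zero, add_zero]

theorem derivation_mem {ι : Type*} {s : Set ι}
    {D : Derivation ℂ (MvPolynomial ι ℂ) (MvPolynomial ι ℂ)}
    {S : Subalgebra ℂ (MvPolynomial ι ℂ)} (hs : supported ℂ s ≤ S)
    (h : ∀ g ∈ s, D (X g) ∈ S) {Z : MvPolynomial ι ℂ} (hZ : Z ∈ supported ℂ s) : D Z ∈ S := by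
  have : Z ∈ S ∧ D Z ∈ S := by
    refine supported_induction (p := fun Z => Z ∈ S ∧ D Z ∈ S)
      (fun g hg => ⟨hs (X_mem_supported.2 hg), h g hg⟩)
      (fun c => ⟨S.algebraMap_mem c, by rw [derivation_C]; exact S.zero_mem⟩)
      (fun Y Z hY hZ => ⟨S.add_mem hY.1 hZ.1, by rw [map_add]; exact S.add_mem hY.2 hZ.2⟩)
      (fun Y Z hY hZ => ⟨S.mul_mem hY.1 hZ.1, ?_⟩) hZ
    rw [derivation_mul]
    exact S.add_mem (S.mul_mem hY.1 hZ.2) (S.mul_mem hZ.1 hY.2)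
  exact this.2

theorem wick_le_between_left (i k : Fin 3) (n : ℕ) :
    (wick i n : Subalgebra ℂ (Expr N d)) ≤ between i k := by
  apply supported_mono
  rintro (_ | _ | _) h
  · exact Or.inl h.1
  · exact ⟨Or.inl h.1, Or.inl h.2.1⟩
  · exact h.elim

theorem wick_le_between_right (i k : Fin 3) (n : ℕ) :
    (wick k n : Subalgebra ℂ (Expr N d)) ≤ between i k := by
  apply supported_mono
  rintro (_ | _ | _) h
  · exact Or.inr h.1
  · exact ⟨Or.inr h.1, Or.inr h.2.1⟩
  · exact h.elim

theorem wick_mono (i : Fin 3) {m n : ℕ} (h : m ≤ n) :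
    (wick i m : Subalgebra ℂ (Expr N d)) ≤ wick i n := by
  apply supported_mono
  rintro (_ | _ | _) hg
  · exact ⟨hg.1, hg.2.trans h⟩
  · exact ⟨hg.1, hg.2.1, hg.2.2.trans h⟩
  · exact hg.elim

theorem deltaPart_of_mem_wick {i : Fin 3} {n : ℕ} {Z : Expr N d} (hZ : Z ∈ wick i n) :
    deltaPart Z = Z := by
  refine supported_induction (p := fun Z => deltaPart Z = Z) ?_ deltaPart_C
    (fun Y Z hY hZ => by rw [map_add, hY, hZ]) (fun Y Z hY hZ => by rw [map_mul, hY, hZ]) hZ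
  rintro (_ | _ | _) h
  · exact deltaPart_field _ _ _ _
  · exact deltaPart_quark _ _ _ _ _ _
  · exact h.elim

theorem pd_of_mem_between {i k l : Fin 3} (hi : i ≠ l) (hk : k ≠ l) (μ : Fin 4) {Z : Expr N d}
    (hZ : Z ∈ between i k) : pd l μ Z = 0 := by
  refine derivation_eq_zero ?_ hZ
  rintro (⟨j, _, _, _⟩ | ⟨j, j', _, _, _, _⟩ | ⟨_, j, j', _⟩) h
  · have h1 : j ≠ l := by rcases h with rfl | rfl <;> assumption
    rw [pd_X]; exact if_neg h1
  · have h1 : j ≠ l := by rcases h.1 with rfl | rfl <;> assumption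
    have h2 : j' ≠ l := by rcases h.2 with rfl | rfl <;> assumption
    rw [pd_X]; dsimp only; rw [if_neg h1, if_neg h2, add_zero]
  · obtain ⟨rfl, rfl⟩ := h
    rw [pd_X]; dsimp only; rw [if_neg hi, if_neg hk, sub_zero]

theorem pd_of_mem_wick {i l : Fin 3} (hi : i ≠ l) (μ : Fin 4) {n : ℕ} {Z : Expr N d}
    (hZ : Z ∈ wick i n) : pd l μ Z = 0 :=
  pd_of_mem_between hi hi μ (wick_le_between_left i i n hZ)

theorem pd_mem_wick (i : Fin 3) (μ : Fin 4) {n : ℕ} {Z : Expr N d} (hZ : Z ∈ wick i n) :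
    pd i μ Z ∈ wick i (n + 1) := by
  refine derivation_mem (wick_mono i n.le_succ) ?_ hZ
  rintro (_ | _ | _) h
  · rw [pd_X]; dsimp only; rw [if_pos h.1]
    exact X_mem_supported.2 ⟨h.1, by simpa using h.2⟩
  · rw [pd_X]; dsimp only; rw [if_pos h.1, if_pos h.2.1]
    refine add_mem (X_mem_supported.2 ⟨h.1, h.2.1, ?_⟩) (X_mem_supported.2 ⟨h.1, h.2.1, ?_⟩)
    · have := h.2.2
      simp only [map_add, Finsupp.degree_single]; omega
    · have := h.2.2
      simp only [map_add, Finsupp.degree_single]; omega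
  · exact h.elim

theorem ker_mem_between (b : Base) (i k : Fin 3) (p : OpAlg) :
    (ker b i k p : Expr N d) ∈ between i k := by
  induction p using MvPolynomial.induction_on' with
  | monomial m a =>
    rw [ker_monomial]
    exact mul_mem (Subalgebra.algebraMap_mem _ a) (X_mem_supported.2 ⟨rfl, rfl⟩)
  | add p q hp hq => rw [map_add]; exact add_mem hp hq

/-! ### Contractions create only kernels from the first point to the second. -/

section Products

variable {cF : ℝ} {G : GaugeData N d} (P : GluonOrdering cF) (R : QuarkOrdering G)

theorem contract_X (Z : Expr N d) (g : Gen N d) :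
    contract P R Z (X g) = mkDerivation ℂ (fun h => pair P R g h) Z := mkDerivation_X _ _ _

theorem pair_mem_between {i k : Fin 3} {m n : ℕ} {g h : Gen N d}
    (hg : (X g : Expr N d) ∈ wick i m) (hh : (X h : Expr N d) ∈ wick k n) :
    pair P R g h ∈ between i k := by
  rw [wick, X_mem_supported] at hg hh
  rcases g with ⟨i, φ, a, α⟩ | ⟨i, j, m, n, α, β⟩ | ⟨b, i, j, m⟩
  · rcases h with ⟨k, χ, b, β⟩ | ⟨k, l, m', n', α', β'⟩ | ⟨b, k, l, m⟩
    · obtain ⟨rfl, _⟩ := hg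
      obtain ⟨rfl, _⟩ := hh
      rw [pair]
      split_ifs
      · exact add_mem (ker_mem_between _ _ _ _)
          (mul_mem (C_mem _ _) (ker_mem_between _ _ _ _))
      · exact zero_mem _
    · exact zero_mem _
    · exact zero_mem _
  · rcases h with ⟨k, χ, b, β⟩ | ⟨k, l, m', n', α', β'⟩ | ⟨b, k, l, m⟩
    · exact zero_mem _
    · obtain ⟨rfl, rfl, _⟩ := hg
      obtain ⟨rfl, rfl, _⟩ := hh
      rw [pair]
      split_ifs
      all_goals first
        | exact zero_mem _
        | refine add_mem ?_ ?_
      all_goals first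
        | exact zero_mem _
        | refine mul_mem (X_mem_supported.2 ?_) (add_mem (ker_mem_between _ _ _ _)
            (mul_mem (C_mem _ _) (ker_mem_between _ _ _ _)))
          simp [Gen.Between]
    · exact zero_mem _
  · exact hg.elim

theorem tprod_mem_between {i k : Fin 3} {m n : ℕ} {Y Z : Expr N d} (hY : Y ∈ wick i m)
    (hZ : Z ∈ wick k n) : tprod P R Y Z ∈ between i k := by
  refine add_mem (mul_mem (wick_le_between_left i k m hY) (wick_le_between_right i k n hZ)) ?_
  refine derivation_mem (wick_le_between_left i k m) (fun g hg => ?_) hY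
  rw [contract_X]
  refine derivation_mem (wick_le_between_right i k n) (fun h hh => ?_) hZ
  rw [mkDerivation_X]
  exact pair_mem_between P R (X_mem_supported.2 hg) (X_mem_supported.2 hh)

end Products

/-! ### Exchange of `x` and `x'` -/

theorem pd_mem_supportIdeal (l : Fin 3) (μ : Fin 4) {Z : Expr N d}
    (hZ : Z ∈ (supportIdeal : Ideal (Expr N d))) : pd l μ Z ∈ supportIdeal :=
  pd_mem_diffIdeal l μ hZ

/-- An expression at x and x'' has no kernel linking x and x', even after the swap, so each of its
generators may be moved across δ_{xx'}. -/
theorem relabel_sub_mul_delta_mem {Z : Expr N d} (hZ : Z ∈ between 0 2) :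
    (relabel (Equiv.swap 0 1) Z - Z) * delta 1 0 ∈ (supportIdeal : Ideal (Expr N d)) := by
  refine supported_induction (p := fun Z => (relabel (Equiv.swap 0 1) Z - Z) * delta 1 0
    ∈ (supportIdeal : Ideal (Expr N d))) (fun g hg => ?_) (fun c => ?_) (fun Y Z hY hZ => ?_)
    (fun Y Z hY hZ => ?_) hZ
  · rw [relabel_X]
    -- The relation is used for the swapped generator: moving x' to x sends it back to `g`.
    refine subset_diffIdeal _ (Or.inl ⟨1, 0, g.map (Equiv.swap 0 1), by decide, ?_, ?_⟩)
    · rcases g with _ | _ | ⟨b, i, k, m⟩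
      · trivial
      · trivial
      · obtain ⟨rfl, rfl⟩ := hg
        simp [Gen.map, Gen.NotLinking]
        decide
    · have h : (g.map (Equiv.swap 0 1)).map (Function.update id 1 0) = g := by
        rw [Gen.map_map]
        have h0 : (Function.update id 1 0 ∘ Equiv.swap (0 : Fin 3) 1) 0 = 0 := by decide
        have h2 : (Function.update id 1 0 ∘ Equiv.swap (0 : Fin 3) 1) 2 = 2 := by decide
        rcases g with ⟨i, _, _, _⟩ | ⟨i, k, _, _, _, _⟩ | ⟨b, i, k, m⟩
        · rcases hg with rfl | rfl <;> simp only [Gen.map, h0, h2]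
        · rcases hg with ⟨rfl | rfl, rfl | rfl⟩ <;> simp only [Gen.map, h0, h2]
        · obtain ⟨rfl, rfl⟩ := hg
          simp only [Gen.map, h0, h2]
      rw [h]
  · rw [relabel_C, sub_self, zero_mul]
    exact zero_mem _
  · rw [map_add, add_sub_add_comm, add_mul]
    exact add_mem hY hZ
  · convert add_mem (Ideal.mul_mem_left _ (relabel (Equiv.swap 0 1) Z) hY)
      (Ideal.mul_mem_left _ Y hZ) using 1
    rw [map_mul]
    ring

theorem relabel_mul_delta_sub_mem {Z : Expr N d} (hZ : Z ∈ between 0 2) :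
    relabel (Equiv.swap 0 1) (Z * delta 0 1) - Z * delta 0 1
      ∈ (supportIdeal : Ideal (Expr N d)) := by
  have h1 := relabel_sub_mul_delta_mem hZ
  have h2 := Ideal.mul_mem_left _ Z (delta_comm_mem (N := N) (d := d) (i := 0) (j := 1) (by decide))
  convert add_mem h1 h2 using 1
  rw [map_mul, relabel_delta, Equiv.swap_apply_left, Equiv.swap_apply_right]
  ring

theorem pd_sum_delta (μ : Fin 4) :
    pd 0 μ (delta 0 1 : Expr N d) + pd 1 μ (delta 0 1) = 0 := by
  rw [delta, pd_ker, pd_ker]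
  simp

/-- Symmetrizing `∂_μ (Z(x) δ_{xx'})` in `x`, `x'` moves the derivative onto `Z`. -/
theorem pd_mul_delta_add_relabel_mem (μ : Fin 4) {Z : Expr N d} (hZ : Z ∈ between 0 2) :
    pd 0 μ (Z * delta 0 1) + relabel (Equiv.swap 0 1) (pd 0 μ (Z * delta 0 1))
      - pd 0 μ Z * delta 0 1 ∈ (supportIdeal : Ideal (Expr N d)) := by
  -- Zδ is exchange invariant on the support, so the exchange of ∂_0(Zδ) is ∂_1(Zδ) = Z ∂_1δ. By
  -- translation invariance of δ this cancels the term Z ∂_0δ.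
  have h := pd_mem_supportIdeal 1 μ (relabel_mul_delta_sub_mem hZ)
  have h1 : pd 1 μ Z = 0 := pd_of_mem_between (by decide) (by decide) μ hZ
  have h2 := pd_sum_delta (N := N) (d := d) μ
  rw [relabel_pd, Equiv.swap_apply_left]
  convert h using 1
  rw [map_sub, derivation_mul, derivation_mul, h1]
  linear_combination Z * h2

section Exchange

variable {cF : ℝ} {G : GaugeData N d} {P : GluonOrdering cF} {R : QuarkOrdering G}

/-- The product T of a differentiated δ is not prescribed, but the argument plus its exchange is
congruent to an undifferentiated one. `exchange` carries the swap through T, `support` transports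
the congruence, and `take_out` then applies. -/
theorem obs2_time_ordered_divergence (B : BilocalOrdering P R) {Y : Fin 4 → Expr N d}
    (hY : ∀ μ, Y μ ∈ wick 0 0) {V : Expr N d} (hV : V ∈ wick 2 0) :
    B.T (∑ μ, pd 0 μ (Y μ * delta 0 1)) V
        + relabel (Equiv.swap 0 1) (B.T (∑ μ, pd 0 μ (Y μ * delta 0 1)) V)
        - delta 0 1 * tprod P R (∑ μ, pd 0 μ (Y μ)) V ∈ (supportIdeal : Ideal (Expr N d)) := by
  set Z : Expr N d := ∑ μ, pd 0 μ (Y μ * delta 0 1) with hZ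
  have hdY : ∑ μ, pd 0 μ (Y μ) ∈ (wick 0 1 : Subalgebra ℂ (Expr N d)) :=
    sum_mem fun μ _ => pd_mem_wick 0 μ (hY μ)
  have hfree : deltaPart Z = Z := by
    simp only [hZ, map_sum, deltaPart_pd, map_mul, deltaPart_delta, deltaPart_of_mem_wick (hY _)]
  have hs : Z + relabel (Equiv.swap 0 1) Z - (∑ μ, pd 0 μ (Y μ)) * delta 0 1
      ∈ (supportIdeal : Ideal (Expr N d)) := by
    rw [hZ, map_sum, Finset.sum_mul, ← Finset.sum_add_distrib, ← Finset.sum_sub_distrib]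
    exact sum_mem fun μ _ => pd_mul_delta_add_relabel_mem μ (wick_le_between_left 0 2 0 (hY μ))
  have hfree' : deltaPart (Z + relabel (Equiv.swap 0 1) Z - (∑ μ, pd 0 μ (Y μ)) * delta 0 1)
      = Z + relabel (Equiv.swap 0 1) Z - (∑ μ, pd 0 μ (Y μ)) * delta 0 1 := by
    rw [map_sub, map_add, map_mul, deltaPart_delta, deltaPart_of_mem_wick hdY,
      ← relabel_deltaPart, hfree]
  have h1 := B.support _ hs hfree' V hV
  have h2 := B.exchange Z hfree V hV
  have h3 := B.take_out _ hdY V hV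
  convert add_mem (add_mem h1 h2) h3 using 1
  rw [map_sub, map_add, LinearMap.sub_apply, LinearMap.add_apply]
  ring

/-- Here the derivative stands outside T, so δ is taken out first and the exchange argument is
applied to the time-ordered product itself, an expression at x and x''. -/
theorem obs2_divergence_time_ordered (B : BilocalOrdering P R) (μ : Fin 4) {Y : Expr N d}
    (hY : Y ∈ wick 0 0) {V : Expr N d} (hV : V ∈ wick 2 0) :
    pd 0 μ (B.T (Y * delta 0 1) V) + relabel (Equiv.swap 0 1) (pd 0 μ (B.T (Y * delta 0 1) V))
        - delta 0 1 * pd 0 μ (tprod P R Y V) ∈ (supportIdeal : Ideal (Expr N d)) := by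
  have h1 := pd_mem_supportIdeal 0 μ (B.take_out Y (wick_mono 0 zero_le_one hY) V hV)
  have h2 := relabel_mem_supportIdeal (Equiv.swap 0 1) h1
  have h3 := pd_mul_delta_add_relabel_mem μ (tprod_mem_between P R hY hV)
  convert add_mem (add_mem h1 h2) h3 using 1
  rw [mul_comm (delta 0 1) (pd 0 μ _), mul_comm (delta 0 1) (tprod P R Y V), map_sub (pd 0 μ),
    map_sub (relabel _)]
  ring

/-- Up to the symmetrization in `x` and `x'`, an undifferentiated delta function can be taken out
of an obstruction. -/
theorem obs2_add_relabel_mem (B : BilocalOrdering P R) {Y : Fin 4 → Expr N d}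
    (hY : ∀ μ, Y μ ∈ wick 0 0) {V : Expr N d} (hV : V ∈ wick 2 0) :
    obs2 B (fun μ => Y μ * delta 0 1) V
        + relabel (Equiv.swap 0 1) (obs2 B (fun μ => Y μ * delta 0 1) V)
        - delta 0 1 * obs P R 0 Y V ∈ (supportIdeal : Ideal (Expr N d)) := by
  have h1 := obs2_time_ordered_divergence B hY hV
  have h2 := sum_mem fun μ (_ : μ ∈ Finset.univ) => obs2_divergence_time_ordered B μ (hY μ) hV
  rw [Finset.sum_sub_distrib, Finset.sum_add_distrib, ← map_sum, ← Finset.mul_sum] at h2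
  convert sub_mem h1 h2 using 1
  rw [obs2, obs, map_sub]
  ring

theorem symm3_deltaPart_obs2_mem (B : BilocalOrdering P R) {Y : Fin 4 → Expr N d}
    (hY : ∀ μ, Y μ ∈ wick 0 0) {V : Expr N d} (hV : V ∈ wick 2 0)
    (h : delta 0 1 * deltaPart (obs P R 0 Y V) ∈ (supportIdeal : Ideal (Expr N d))) :
    symm3 (deltaPart (obs2 B (fun μ => Y μ * delta 0 1) V))
      ∈ (supportIdeal : Ideal (Expr N d)) := by
  have h1 := deltaPart_mem_supportIdeal (obs2_add_relabel_mem B hY hV)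
  rw [map_sub, map_add, map_mul, deltaPart_delta, ← relabel_deltaPart] at h1
  have h2 := add_mem h1 h
  rw [sub_add_cancel] at h2
  have h3 := symm3_mem_of_relabel_mem (fun σ => relabel_mem_supportIdeal σ h2)
  rw [symm3_add, symm3_relabel] at h3
  -- Under 𝔖 the obstruction and its exchange agree, so `h3` contains twice the wanted term.
  have h4 := Ideal.mul_mem_left _ (C (1 / 2)) h3
  rw [← two_mul, ← mul_assoc] at h4
  have h5 : (C (1 / 2) * 2 : Expr N d) = 1 := by
    rw [show (2 : Expr N d) = C 2 from (map_ofNat C 2).symm, ← C_mul]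
    norm_num
  rwa [h5, one_mul] at h4

end Exchange

/-! ### Obstructions at tree level -/

section Obstruction

variable {cF : ℝ} {G : GaugeData N d} (P : GluonOrdering cF) (R : QuarkOrdering G)

/-- The obstruction is a derivation in its first argument. -/
theorem obs_eq_commutator {i k : Fin 3} (hik : k ≠ i) (Y : Fin 4 → Expr N d) {n : ℕ}
    {Z : Expr N d} (hZ : Z ∈ wick k n) :
    obs P R i Y Z = ∑ μ, ⁅contract P R Z, pd i μ⁆ (Y μ) := by
  have h (μ : Fin 4) : pd i μ Z = 0 := pd_of_mem_wick hik μ hZ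
  simp only [obs, tprod, Derivation.commutator_apply, map_add, derivation_mul, h, map_sum,
    Finset.sum_sub_distrib, Finset.sum_add_distrib, Finset.sum_mul, mul_zero, zero_add]
  simp only [mul_comm Z]
  ring

/-- The string-free part of the two-point obstruction `O_μ(φ, ·)` of a gluon field at `x_i` with
the generators at `x_k`, as a derivation. -/
noncomputable def gluonObs (i k : Fin 3) (μ : Fin 4) (φ : Species) (a : Fin N) :
    Derivation ℂ (Expr N d) (Expr N d) :=
  mkDerivation ℂ (fun h => match h with
    | .field _ χ b _ =>
        if a = b then C Complex.I * deltaPart (ker .delta i k (P.o μ φ χ)) else 0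
    | _ => 0)

theorem firstOrder_zero (F : Fin 4 → OpAlg) : firstOrder 0 F = 0 := by
  refine Finset.sum_eq_zero fun μ _ => if_neg fun h => ?_
  have := DFunLike.congr_fun h μ
  simp at this

theorem firstOrder_single (μ : Fin 4) (F : Fin 4 → OpAlg) :
    firstOrder (Finsupp.single μ 1) F = F μ := by
  rw [firstOrder, Finset.sum_eq_single μ]
  · exact if_pos rfl
  · intro ν _ hν
    exact if_neg fun h => hν (Finsupp.single_left_injective one_ne_zero h).symm
  · exact fun h => absurd (Finset.mem_univ μ) h

theorem dPow_zero : dPow 0 = 1 := Finsupp.prod_zero_index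

theorem dPow_single (μ : Fin 4) : dPow (Finsupp.single μ 1) = dd μ := by
  rw [dPow, Finsupp.prod_single_index (h := fun μ n => dd μ ^ n) (pow_zero _), pow_one]

/-- The T_0 term and the c_F term are both differentiated by the same operator inside and outside T
and cancel; only the chosen two-point obstruction remains. -/
theorem gluonContraction_sub {i k : Fin 3} (hik : k ≠ i) (μ : Fin 4) (φ χ : Species) :
    gluonContraction P i k φ χ (Finsupp.single μ 1) - pd i μ (gluonContraction P i k φ χ 0)
      = (C Complex.I * ker .delta i k (P.o μ φ χ) : Expr N d) := by
  rw [gluonContraction, gluonContraction, firstOrder_single, firstOrder_zero, dPow_single,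
    dPow_zero, one_mul, one_mul, add_zero, map_add, map_add (pd i μ), derivation_mul, derivation_C,
    pd_ker, pd_ker, if_pos rfl, if_neg hik, if_pos rfl, if_neg hik]
  ring

theorem deltaPart_commutator_field {i k : Fin 3} (hik : k ≠ i) (μ : Fin 4) (φ : Species)
    (a : Fin N) {Z : Expr N d} (hZ : Z ∈ wick k 0) :
    deltaPart (⁅contract P R Z, pd i μ⁆ (X (.field i φ a 0)))
      = gluonObs P i k μ φ a Z := by
  rw [Derivation.commutator_apply, pd_X]
  dsimp only
  rw [if_pos rfl, zero_add, contract_X, contract_X]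
  have hZ' := hZ
  -- Membership is carried through the induction because the product step needs both factors to be
  -- constant in x_i and fixed by `deltaPart`.
  suffices h : Z ∈ (wick k 0 : Subalgebra ℂ (Expr N d)) ∧
      deltaPart ((mkDerivation ℂ fun h => pair P R (.field i φ a (Finsupp.single μ 1)) h) Z
        - pd i μ ((mkDerivation ℂ fun h => pair P R (.field i φ a 0) h) Z))
      = gluonObs P i k μ φ a Z from h.2
  refine supported_induction (p := fun Z => Z ∈ (wick k 0 : Subalgebra ℂ (Expr N d)) ∧
      deltaPart ((mkDerivation ℂ fun h => pair P R (.field i φ a (Finsupp.single μ 1)) h) Z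
        - pd i μ ((mkDerivation ℂ fun h => pair P R (.field i φ a 0) h) Z))
      = gluonObs P i k μ φ a Z) (fun g hg => ⟨X_mem_supported.2 hg, ?_⟩)
    (fun c => ⟨Subalgebra.algebraMap_mem _ c, ?_⟩) (fun Y Z hY hZ => ⟨add_mem hY.1 hZ.1, ?_⟩)
    (fun Y Z hY hZ => ⟨mul_mem hY.1 hZ.1, ?_⟩) hZ
  · rw [gluonObs, mkDerivation_X, mkDerivation_X, mkDerivation_X]
    rcases g with ⟨j, χ, b, β⟩ | _ | _
    · obtain ⟨rfl, hβ⟩ := hg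
      have hβ : β = 0 := by
        rw [← Finsupp.degree_eq_zero_iff]; omega
      subst hβ
      simp only [pair, and_true]
      split_ifs
      · rw [gluonContraction_sub P hik, map_mul, deltaPart_C]
      · rw [map_zero, sub_zero, map_zero]
    · simp only [pair, map_zero, sub_zero]
    · exact hg.elim
  · simp only [derivation_C, map_zero, sub_zero]
  · rw [map_add (gluonObs P i k μ φ a), ← hY.2, ← hZ.2]
    simp only [map_add, map_sub]
    ring
  · have h1 : pd i μ Y = 0 := pd_of_mem_wick hik μ hY.1
    have h2 : pd i μ Z = 0 := pd_of_mem_wick hik μ hZ.1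
    have h3 := deltaPart_of_mem_wick hY.1
    have h4 := deltaPart_of_mem_wick hZ.1
    rw [derivation_mul (gluonObs P i k μ φ a), ← hY.2, ← hZ.2]
    simp only [derivation_mul, map_add, map_sub, map_mul, h1, h2, h3, h4, mul_zero, add_zero]
    ring

/-- The string-free part of the obstruction of `Z`, as a derivation in the first argument. -/
noncomputable def localObs (i : Fin 3) (μ : Fin 4) (Z : Expr N d) :
    Derivation ℂ (Expr N d) (Expr N d) :=
  mkDerivation ℂ (fun g => deltaPart (⁅contract P R Z, pd i μ⁆ (X g)))

/-- Following a derivation by `deltaPart` obeys the Leibniz rule only on factors fixed by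
`deltaPart`. Wick polynomials are such, so the values on generators decide. -/
theorem deltaPart_commutator (i : Fin 3) (μ : Fin 4) (Z₀ : Expr N d) {n : ℕ} {Y : Expr N d}
    (hY : Y ∈ wick i n) :
    deltaPart (⁅contract P R Z₀, pd i μ⁆ Y) = localObs P R i μ Z₀ Y := by
  have h : deltaPart Y = Y ∧ deltaPart (⁅contract P R Z₀, pd i μ⁆ Y) = localObs P R i μ Z₀ Y := by
    refine supported_induction (p := fun Y => deltaPart Y = Y ∧
      deltaPart (⁅contract P R Z₀, pd i μ⁆ Y) = localObs P R i μ Z₀ Y) (fun g hg =>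
        ⟨deltaPart_of_mem_wick (i := i) (n := n) (X_mem_supported.2 hg), by
          rw [localObs, mkDerivation_X]⟩)
      (fun c => ⟨deltaPart_C c, by rw [derivation_C, derivation_C, map_zero]⟩)
      (fun Y Z hY hZ => ⟨by rw [map_add, hY.1, hZ.1], ?_⟩)
      (fun Y Z hY hZ => ⟨by rw [map_mul, hY.1, hZ.1], ?_⟩) hY
    · rw [map_add ⁅contract P R Z₀, pd i μ⁆, map_add deltaPart, map_add (localObs P R i μ Z₀), hY.2,
        hZ.2]
    · rw [derivation_mul, derivation_mul, map_add deltaPart, map_mul, map_mul, hY.2, hZ.2, hY.1,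
        hZ.1]
  exact h.2

theorem deltaPart_obs {i k : Fin 3} (hik : k ≠ i) {Y : Fin 4 → Expr N d} {m n : ℕ}
    (hY : ∀ μ, Y μ ∈ wick i m) {Z : Expr N d} (hZ : Z ∈ wick k n) :
    deltaPart (obs P R i Y Z) = ∑ μ, localObs P R i μ Z (Y μ) := by
  rw [obs_eq_commutator P R hik Y hZ, map_sum]
  exact Finset.sum_congr rfl fun μ _ => deltaPart_commutator P R i μ Z (hY μ)

theorem localObs_field {i k : Fin 3} (hik : k ≠ i) (μ : Fin 4) (φ : Species) (a : Fin N)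
    {Z : Expr N d} (hZ : Z ∈ wick k 0) :
    localObs P R i μ Z (X (.field i φ a 0)) = gluonObs P i k μ φ a Z := by
  rw [localObs, mkDerivation_X, deltaPart_commutator_field P R hik μ φ a hZ]

/-- The Wick polynomials in the potential at `x_k`. -/
noncomputable def potentials (k : Fin 3) : Subalgebra ℂ (Expr N d) :=
  supported ℂ {g | ∃ μ a, g = .field k (.A μ) a 0}

theorem potentials_le_wick (k : Fin 3) : (potentials k : Subalgebra ℂ (Expr N d)) ≤ wick k 0 := by
  apply supported_mono
  rintro _ ⟨μ, a, rfl⟩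
  exact ⟨rfl, by simp⟩

theorem localObs_quark (i k : Fin 3) (μ : Fin 4) (m n : Fin 4 × Fin d)
    {Z : Expr N d} (hZ : Z ∈ potentials k) :
    localObs P R i μ Z (X (.quark i i m n 0 0)) = 0 := by
  have h (α β : Multi) : contract P R Z (X (.quark i i m n α β)) = 0 := by
    rw [contract_X]
    refine derivation_eq_zero ?_ hZ
    rintro _ ⟨ν, a, rfl⟩
    rw [mkDerivation_X, pair]
    all_goals simp
  rw [localObs, mkDerivation_X, Derivation.commutator_apply, pd_X]
  simp [h]

end Obstruction

/-! ### Colour algebra -/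

section Colour

variable (G : GaugeData N d) (U V W : Fin N → Expr N d)

theorem inn_comm : inn U V = inn V U :=
  Finset.sum_congr rfl fun _ _ => mul_comm _ _

theorem brk_swap : brk G V U = -brk G U V := by
  funext c
  simp only [brk, Pi.neg_apply, neg_neg]
  rw [Finset.sum_comm, ← Finset.sum_neg_distrib]
  refine Finset.sum_congr rfl fun a _ => ?_
  rw [← Finset.sum_neg_distrib]
  refine Finset.sum_congr rfl fun b _ => ?_
  rw [G.antisymm₁₂ b a c, Complex.ofReal_neg, C_neg]
  ring

/-- This is total antisymmetry of the structure constants: a cyclic permutation of the indices of f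
is even. -/
theorem inn_brk_cycle : inn U (brk G V W) = inn V (brk G W U) := by
  simp only [inn, brk, mul_neg, Finset.mul_sum, Finset.sum_neg_distrib, neg_inj]
  rw [Finset.sum_comm]
  refine Finset.sum_congr rfl fun a _ => ?_
  rw [Finset.sum_comm]
  refine Finset.sum_congr rfl fun b _ => Finset.sum_congr rfl fun c _ => ?_
  rw [G.antisymm₁₂ a b c, G.antisymm₂₃ b a c, neg_neg]
  ring

theorem inn_neg_left : inn (-U) V = -inn U V := by
  simp only [inn, Pi.neg_apply, neg_mul, Finset.sum_neg_distrib]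

theorem inn_neg_right : inn U (-V) = -inn U V := by
  rw [inn_comm, inn_neg_left, inn_comm]

theorem inn_add_left : inn (U + V) W = inn U W + inn V W := by
  simp only [inn, Pi.add_apply, add_mul, Finset.sum_add_distrib]

theorem inn_add_right : inn U (V + W) = inn U V + inn U W := by
  rw [inn_comm, inn_add_left, inn_comm V, inn_comm W]

theorem brk_neg_right : brk G U (-V) = -brk G U V := by
  funext c
  simp only [brk, Pi.neg_apply, mul_neg, Finset.sum_neg_distrib]

theorem inn_brk_self : inn U (brk G V U) = 0 := by
  have h : inn U (brk G V U) = -inn U (brk G V U) := by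
    rw [← inn_neg_right, ← brk_swap, inn_brk_cycle, inn_brk_cycle]
  have h2 : (2 : Expr N d) * inn U (brk G V U) = 0 := by linear_combination h
  exact (mul_eq_zero.1 h2).resolve_left two_ne_zero

theorem sum_rotate {M : Type*} [AddCommMonoid M] (F : Fin N → Fin N → Fin N → M) :
    ∑ x, ∑ a, ∑ p, F x a p = ∑ a, ∑ p, ∑ x, F x a p := by
  rw [Finset.sum_comm]
  exact Finset.sum_congr rfl fun a _ => Finset.sum_comm

/-- The bracket i[·,·] acts as a derivation of itself. The proof compares the coefficients of U^a
V^p W^q. -/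
theorem brk_jacobi : brk G U (brk G V W) = brk G (brk G U V) W + brk G V (brk G U W) := by
  funext c
  have h1 : brk G U (brk G V W) c
      = ∑ a, ∑ p, ∑ q, C (∑ e, (G.f p q e * G.f a e c : ℂ)) * (U a * V p * W q) := by
    simp only [brk, mul_neg, Finset.sum_neg_distrib, neg_neg, Finset.mul_sum, map_sum,
      Finset.sum_mul]
    refine Finset.sum_congr rfl fun a _ => ?_
    rw [Finset.sum_comm]
    refine Finset.sum_congr rfl fun p _ => ?_
    rw [Finset.sum_comm]
    refine Finset.sum_congr rfl fun q _ => Finset.sum_congr rfl fun e _ => ?_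
    rw [C_mul]; ring
  have h2 : brk G (brk G U V) W c
      = ∑ a, ∑ p, ∑ q, C (∑ e, (G.f a p e * G.f e q c : ℂ)) * (U a * V p * W q) := by
    simp only [brk, mul_neg, neg_mul, Finset.sum_neg_distrib, neg_neg, Finset.mul_sum, map_sum,
      Finset.sum_mul]
    rw [Finset.sum_comm, Finset.sum_congr rfl fun q _ => sum_rotate _, sum_rotate]
    refine Finset.sum_congr rfl fun a _ => Finset.sum_congr rfl fun p _ =>
      Finset.sum_congr rfl fun q _ => Finset.sum_congr rfl fun e _ => ?_
    rw [C_mul]; ring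
  have h3 : brk G V (brk G U W) c
      = ∑ a, ∑ p, ∑ q, C (∑ e, (G.f a q e * G.f p e c : ℂ)) * (U a * V p * W q) := by
    simp only [brk, mul_neg, Finset.sum_neg_distrib, neg_neg, Finset.mul_sum, map_sum,
      Finset.sum_mul]
    rw [Finset.sum_congr rfl fun p _ => sum_rotate _, Finset.sum_comm]
    refine Finset.sum_congr rfl fun a _ => Finset.sum_congr rfl fun p _ =>
      Finset.sum_congr rfl fun q _ => Finset.sum_congr rfl fun e _ => ?_
    rw [C_mul]; ring
  rw [Pi.add_apply, h1, h2, h3]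
  simp only [← Finset.sum_add_distrib, ← add_mul, ← C_add]
  refine Finset.sum_congr rfl fun a _ => Finset.sum_congr rfl fun p _ =>
    Finset.sum_congr rfl fun q _ => ?_
  congr 2
  have hJ := congrArg (fun x : ℝ => (x : ℂ)) (G.jacobi a p q c)
  simp only [Complex.ofReal_sum, Complex.ofReal_add, Complex.ofReal_mul, Complex.ofReal_zero] at hJ
  rw [← sub_eq_zero, ← neg_eq_zero, ← hJ, ← Finset.sum_sub_distrib, ← Finset.sum_neg_distrib]
  refine Finset.sum_congr rfl fun e _ => ?_
  -- Antisymmetry brings the three products into the cyclic form of `jacobi a p q c`.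
  rw [G.antisymm₁₂ a e c, G.antisymm₁₂ p e c, G.antisymm₁₂ q a e]
  push_cast
  ring

variable (D : Derivation ℂ (Expr N d) (Expr N d))

theorem derivation_inn :
    D (inn U V) = inn (fun a => D (U a)) V + inn U (fun a => D (V a)) := by
  simp only [inn, map_sum, ← Finset.sum_add_distrib]
  refine Finset.sum_congr rfl fun a _ => ?_
  rw [D.leibniz, smul_eq_mul, smul_eq_mul]
  ring

theorem derivation_brk :
    (fun c => D (brk G U V c)) = brk G (fun a => D (U a)) V + brk G U (fun a => D (V a)) := by
  funext c
  have h (a b : Fin N) : D (C (G.f a b c : ℂ) * U a * V b)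
      = C (G.f a b c : ℂ) * D (U a) * V b + C (G.f a b c : ℂ) * U a * D (V b) := by
    rw [mul_assoc, ← smul_eq_C_mul, D.map_smul, D.leibniz, smul_eq_C_mul, smul_eq_mul,
      smul_eq_mul]
    ring
  simp only [brk, Pi.add_apply, map_neg, map_sum, h, Finset.sum_add_distrib]
  ring

end Colour

/-! ### Lorentz invariant tensors -/

/-- The linear map that mixes the axes `α` and `β`. -/
def mix (α β : Fin 4) (c s s' : ℝ) : Matrix (Fin 4) (Fin 4) ℝ := fun i j =>
  if j = α then (if i = α then c else if i = β then s else 0)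
  else if j = β then (if i = β then c else if i = α then s' else 0)
  else if i = j then 1 else 0

theorem mix_comm {α β : Fin 4} (h : α ≠ β) (c s s' : ℝ) : mix α β c s s' = mix β α c s' s := by
  have := h.symm
  funext i j
  unfold mix
  split_ifs <;> first | rfl | (exfalso; simp_all)

set_option maxHeartbeats 1000000 in
theorem isLorentz_boost {β : Fin 4} (h : β ≠ 0) : IsLorentz (mix 0 β (5 / 4) (3 / 4) (3 / 4)) := by
  refine ⟨?_, ?_, by norm_num [mix]⟩
  · ext i j
    fin_cases β <;> first
      | exact absurd rfl h
      | (fin_cases i <;> fin_cases j <;>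
          simp [Matrix.mul_apply, Fin.sum_univ_four, mix, Matrix.diagonal] <;> norm_num)
  · fin_cases β <;> first
      | exact absurd rfl h
      | (simp [Matrix.det_succ_row_zero, Fin.sum_univ_succ, mix, Fin.succAbove]; norm_num)

set_option maxHeartbeats 1000000 in
theorem isLorentz_rotation {α β : Fin 4} (hα : α ≠ 0) (hβ : β ≠ 0) (h : α < β) {c s : ℝ}
    (hc : c ^ 2 + s ^ 2 = 1) : IsLorentz (mix α β c s (-s)) := by
  refine ⟨?_, ?_, by norm_num [mix, hα.symm, hβ.symm]⟩
  · ext i j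
    fin_cases α <;> fin_cases β <;> first
      | exact absurd rfl hα
      | exact absurd rfl hβ
      | exact absurd h (by decide)
      | (fin_cases i <;> fin_cases j <;>
          simp [Matrix.mul_apply, Fin.sum_univ_four, mix, Matrix.diagonal] <;> linarith)
  · fin_cases α <;> fin_cases β <;> first
      | exact absurd rfl hα
      | exact absurd rfl hβ
      | exact absurd h (by decide)
      | (simp [Matrix.det_succ_row_zero, Fin.sum_univ_succ, mix, Fin.succAbove]; linarith)

/-- Boosts and rotations in the coordinate planes. -/
theorem exists_isLorentz_mix {α β : Fin 4} (h : α ≠ β) :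
    ∃ c s s' : ℝ, c ^ 2 - s * s' = 1 ∧ s * s' ≠ 0 ∧ IsLorentz (mix α β c s s') := by
  by_cases hα : α = 0
  · subst hα
    -- A rational point on the hyperbola c² - s² = 1 suffices, as does 3/5, 4/5 on the circle below:
    -- only c² - s s' = 1 and s s' ≠ 0 matter later.
    exact ⟨5 / 4, 3 / 4, 3 / 4, by norm_num, by norm_num, isLorentz_boost h.symm⟩
  by_cases hβ : β = 0
  · subst hβ
    refine ⟨5 / 4, 3 / 4, 3 / 4, by norm_num, by norm_num, ?_⟩
    rw [mix_comm h]
    exact isLorentz_boost h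
  rcases lt_or_gt_of_ne h with hlt | hlt
  · exact ⟨3 / 5, 4 / 5, -(4 / 5), by norm_num, by norm_num,
      isLorentz_rotation hα hβ hlt (by norm_num)⟩
  · refine ⟨3 / 5, -(4 / 5), 4 / 5, by norm_num, by norm_num, ?_⟩
    rw [mix_comm h]
    exact isLorentz_rotation hβ hα hlt (by norm_num)

theorem sum_mix_left {α β : Fin 4} (h : α ≠ β) (c s s' : ℝ) (g : Fin 4 → ℂ) :
    ∑ i, (mix α β c s s' i α : ℂ) * g i = c * g α + s * g β := by
  rw [Finset.sum_eq_add α β h]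
  · simp [mix, h.symm]
  · rintro i - ⟨h1, h2⟩; simp [mix, h1, h2]
  · simp
  · simp

theorem sum_mix_right {α β : Fin 4} (h : α ≠ β) (c s s' : ℝ) (g : Fin 4 → ℂ) :
    ∑ i, (mix α β c s s' i β : ℂ) * g i = c * g β + s' * g α := by
  rw [mix_comm h, sum_mix_left h.symm]

theorem sum_mix_of_ne {α β γ : Fin 4} (hα : γ ≠ α) (hβ : γ ≠ β) (c s s' : ℝ) (g : Fin 4 → ℂ) :
    ∑ i, (mix α β c s s' i γ : ℂ) * g i = g γ := by
  rw [Finset.sum_eq_single γ]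
  · simp [mix, hα, hβ]
  · intro i _ h1; simp [mix, hα, hβ, h1]
  · simp

/-- The sign of the axis `μ` under the rotation by `π` in the plane of `α` and `β`. -/
def axisSign (α β μ : Fin 4) : ℤ := if μ = α ∨ μ = β then -1 else 1

/-- The entry `-0` is the form that `isLorentz_rotation` yields for `s = 0`. -/
theorem sum_mix_flip {α β : Fin 4} (h : α ≠ β) (μ : Fin 4) (g : Fin 4 → ℂ) :
    ∑ i, (mix α β (-1) 0 (-0) i μ : ℂ) * g i = axisSign α β μ * g μ := by
  by_cases hα : μ = α
  · subst hα; rw [sum_mix_left h]; simp [axisSign]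
  by_cases hβ : μ = β
  · subst hβ; rw [sum_mix_right h]; simp [axisSign]
  rw [sum_mix_of_ne hα hβ]; simp [axisSign, hα, hβ]

/-- Invariant tensors of rank two. -/
def IsInvariant₂ (b : Fin 4 → Fin 4 → ℂ) : Prop :=
  ∀ Λ : Matrix (Fin 4) (Fin 4) ℝ, IsLorentz Λ → ∀ μ ν,
    b μ ν = ∑ μ', (Λ μ' μ : ℂ) * ∑ ν', (Λ ν' ν : ℂ) * b μ' ν'

/-- Invariant tensors of rank four. -/
def IsInvariant₄ (b : Fin 4 → Fin 4 → Fin 4 → Fin 4 → ℂ) : Prop :=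
  ∀ Λ : Matrix (Fin 4) (Fin 4) ℝ, IsLorentz Λ → ∀ μ ν ρ σ,
    b μ ν ρ σ = ∑ μ', (Λ μ' μ : ℂ) * ∑ ν', (Λ ν' ν : ℂ) * ∑ ρ', (Λ ρ' ρ : ℂ) *
      ∑ σ', (Λ σ' σ : ℂ) * b μ' ν' ρ' σ'

/-- For two distinct axes some spatial plane contains exactly one of them, and the rotation by π in
that plane reverses the sign of the entry. -/
theorem IsInvariant₂.eq_zero {b : Fin 4 → Fin 4 → ℂ} (hb : IsInvariant₂ b) {μ ν : Fin 4}
    (h : μ ≠ ν) : b μ ν = 0 := by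
  have key : ∀ μ ν : Fin 4, μ ≠ ν → ∃ α β : Fin 4, (α ≠ 0 ∧ β ≠ 0 ∧ α < β) ∧
      axisSign α β μ * axisSign α β ν = -1 := by decide
  obtain ⟨α, β, ⟨hα, hβ, hlt⟩, hs⟩ := key μ ν h
  have h1 := hb _ (isLorentz_rotation hα hβ hlt (c := -1) (s := 0) (by norm_num)) μ ν
  simp only [sum_mix_flip hlt.ne] at h1
  rw [← mul_assoc, ← Int.cast_mul, hs] at h1
  push_cast at h1
  linear_combination h1 / 2

theorem IsInvariant₂.eq_eta {b : Fin 4 → Fin 4 → ℂ} (hb : IsInvariant₂ b) (μ ν : Fin 4) :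
    b μ ν = b 0 0 * eta μ ν := by
  by_cases h : μ = ν
  · subst h
    by_cases h0 : μ = 0
    · subst h0; simp [eta, sg]
    -- Off-diagonal entries being zero, the boost gives b_00 = (25/16) b_00 + (9/16) b_μμ, so b_μμ =
    -- -b_00.
    · have h1 := hb _ (isLorentz_boost h0) 0 0
      simp only [sum_mix_left (Ne.symm h0)] at h1
      rw [hb.eq_zero h0, hb.eq_zero (Ne.symm h0)] at h1
      push_cast at h1
      simp only [eta, sg, if_true, if_neg h0]
      linear_combination (-16 / 9) * h1
  · rw [hb.eq_zero h, eta, if_neg h, mul_zero]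

/-- A left inverse of a square matrix is a right inverse, so ΛᵀEΛ = E implies ΛEΛᵀ = E, the form
needed to contract two indices of a covariant tensor. -/
theorem isLorentz_transpose_apply {Λ : Matrix (Fin 4) (Fin 4) ℝ} (h : IsLorentz Λ) (i k : Fin 4) :
    ∑ μ, sg μ * (Λ i μ : ℂ) * (Λ k μ : ℂ) = eta i k := by
  set E : Matrix (Fin 4) (Fin 4) ℝ := Matrix.diagonal (fun μ : Fin 4 => if μ = 0 then (1 : ℝ) else -1)
    with hE
  have hEE : E * E = 1 := by
    rw [hE, Matrix.diagonal_mul_diagonal, ← Matrix.diagonal_one]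
    congr 1
    funext μ
    split_ifs <;> norm_num
  have h1 : (E * Λ.transpose * E) * Λ = 1 := by
    rw [Matrix.mul_assoc, Matrix.mul_assoc, ← Matrix.mul_assoc Λ.transpose, h.1, hEE]
  have h2 : Λ * (E * Λ.transpose * E) = 1 := mul_eq_one_comm.1 h1
  have h3 : Λ * E * Λ.transpose = E := by
    calc Λ * E * Λ.transpose = Λ * (E * Λ.transpose * E) * E := by
          simp only [Matrix.mul_assoc, hEE, Matrix.mul_one]
      _ = E := by rw [h2, Matrix.one_mul]
  have h4 := congrArg (fun x : ℝ => (x : ℂ)) (congrFun (congrFun h3 i) k)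
  rw [Matrix.mul_apply] at h4
  simp only [hE, Matrix.mul_diagonal, Matrix.transpose_apply] at h4
  have h5 : (((Matrix.diagonal fun μ : Fin 4 => if μ = 0 then (1 : ℝ) else -1) i k : ℝ) : ℂ)
      = eta i k := by
    rw [Matrix.diagonal_apply, eta, sg]
    split_ifs <;> simp
  rw [← h5, ← h4, Complex.ofReal_sum]
  refine Finset.sum_congr rfl fun μ _ => ?_
  rw [sg]
  split_ifs <;> push_cast <;> ring

theorem IsInvariant₄.contract {b : Fin 4 → Fin 4 → Fin 4 → Fin 4 → ℂ} (hb : IsInvariant₄ b) :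
    IsInvariant₂ (fun ν l => ∑ μ, sg μ * b μ μ ν l) := by
  intro Λ hΛ ν l
  let X (μ κ : Fin 4) : ℂ := ∑ ν', (Λ ν' ν : ℂ) * ∑ l', (Λ l' l : ℂ) * b μ κ ν' l'
  have h1 : ∑ μ, sg μ * b μ μ ν l = ∑ i, ∑ k, (∑ μ, sg μ * (Λ i μ : ℂ) * (Λ k μ : ℂ)) * X i k := by
    have (μ : Fin 4) : sg μ * b μ μ ν l
        = ∑ i, ∑ k, sg μ * (Λ i μ : ℂ) * (Λ k μ : ℂ) * X i k := by
      rw [hb Λ hΛ μ μ ν l]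
      simp only [Finset.mul_sum, X, mul_assoc]
    simp only [this, Finset.sum_mul]
    rw [Finset.sum_comm]
    exact Finset.sum_congr rfl fun i _ => Finset.sum_comm
  have h2 : ∑ i, ∑ k, eta i k * X i k = ∑ μ, sg μ * X μ μ := by
    simp [eta]
  simp only [isLorentz_transpose_apply hΛ] at h1
  change ∑ μ, sg μ * b μ μ ν l
    = ∑ ν', (Λ ν' ν : ℂ) * ∑ l', (Λ l' l : ℂ) * ∑ μ, sg μ * b μ μ ν' l'
  rw [h1, h2]
  simp only [X, Finset.mul_sum]
  rw [Finset.sum_comm]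
  refine Finset.sum_congr rfl fun ν' _ => ?_
  rw [Finset.sum_comm]
  refine Finset.sum_congr rfl fun l' _ => Finset.sum_congr rfl fun μ _ => ?_
  ring

/-! ### Rank-four invariant tensors antisymmetric in the last pair. -/

section RankFour

variable {b : Fin 4 → Fin 4 → Fin 4 → Fin 4 → ℂ}

theorem IsInvariant₄.eq_zero_of_sign (hb : IsInvariant₄ b) {μ ν ρ σ : Fin 4}
    (h : ∃ α β : Fin 4, (α ≠ 0 ∧ β ≠ 0 ∧ α < β) ∧
      axisSign α β μ * (axisSign α β ν * (axisSign α β ρ * axisSign α β σ)) = -1) :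
    b μ ν ρ σ = 0 := by
  obtain ⟨α, β, ⟨hα, hβ, hlt⟩, hs⟩ := h
  have h1 := hb _ (isLorentz_rotation hα hβ hlt (c := -1) (s := 0) (by norm_num)) μ ν ρ σ
  simp only [sum_mix_flip hlt.ne] at h1
  have hs' := congrArg (fun n : ℤ => (n : ℂ)) hs
  push_cast at hs'
  linear_combination (1 / 2 : ℂ) * h1 + (1 / 2 : ℂ) * b μ ν ρ σ * hs'

set_option maxRecDepth 100000 in
-- Spatial rotations by π see only the parity with which each axis occurs. An entry survives if all
-- parities are even, which for ρ ≠ σ means {μ, ν} = {ρ, σ}, or if all four axes occur once.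
theorem indices_cases : ∀ μ ν ρ σ : Fin 4, ρ ≠ σ →
    (∃ α β : Fin 4, (α ≠ 0 ∧ β ≠ 0 ∧ α < β) ∧
      axisSign α β μ * (axisSign α β ν * (axisSign α β ρ * axisSign α β σ)) = -1) ∨
    (μ = ρ ∧ ν = σ) ∨ (μ = σ ∧ ν = ρ) ∨
    (μ ≠ ν ∧ μ ≠ ρ ∧ μ ≠ σ ∧ ν ≠ ρ ∧ ν ≠ σ) := by decide

theorem IsInvariant₄.diagonal_eq_zero (hb : IsInvariant₄ b)
    (h : ∀ μ ν ρ σ, b μ ν σ ρ = -b μ ν ρ σ) (μ ρ σ : Fin 4) : b μ μ ρ σ = 0 := by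
  by_cases hρσ : ρ = σ
  · subst hρσ
    linear_combination (1 / 2 : ℂ) * h μ μ ρ ρ
  · rcases indices_cases μ μ ρ σ hρσ with h0 | ⟨rfl, h1⟩ | ⟨rfl, h1⟩ | ⟨h1, _⟩
    · exact hb.eq_zero_of_sign h0
    · exact absurd h1 hρσ
    · exact absurd h1.symm hρσ
    · exact absurd rfl h1

/-- An invariant tensor that is antisymmetric in the last two indices is antisymmetric in the
first two. -/
theorem IsInvariant₄.antisymm_left (hb : IsInvariant₄ b)
    (h : ∀ μ ν ρ σ, b μ ν σ ρ = -b μ ν ρ σ) (μ ν ρ σ : Fin 4) : b ν μ ρ σ = -b μ ν ρ σ := by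
  have h0 := hb.diagonal_eq_zero h
  by_cases hρσ : ρ = σ
  · subst hρσ
    linear_combination (1 / 2 : ℂ) * h μ ν ρ ρ + (1 / 2 : ℂ) * h ν μ ρ ρ
  have hpair (μ ν : Fin 4) : b ν μ μ ν = -b μ ν μ ν := by
    by_cases hμν : μ = ν
    · subst hμν
      rw [h0, neg_zero]
    -- The antisymmetric last pair picks up the determinant c² - s s' = 1, and terms with equal
    -- first indices vanish. Thus b_{μν} = c² b_{μν} + s s' b_{νμ} with the last pair held fixed,
    -- which is s s' times the claim.
    obtain ⟨c, s, s', h1, h2, hΛ⟩ := exists_isLorentz_mix hμν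
    have h3 := hb _ hΛ μ ν μ ν
    simp only [sum_mix_left hμν, sum_mix_right hμν, h0] at h3
    have h1' : (c : ℂ) ^ 2 - s * s' = 1 := by exact_mod_cast h1
    have h2' : (s : ℂ) * s' ≠ 0 := by exact_mod_cast h2
    have e1 (x y : Fin 4) : b x y ν ν = 0 := by
      linear_combination (1 / 2 : ℂ) * h x y ν ν
    have e2 (x y : Fin 4) : b x y μ μ = 0 := by
      linear_combination (1 / 2 : ℂ) * h x y μ μ
    rw [h μ ν μ ν, h ν μ μ ν, e1, e2, e1, e2] at h3
    apply mul_left_cancel₀ h2'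
    linear_combination -h3 - ((c : ℂ) ^ 2 * b μ ν μ ν + b μ ν μ ν + s * s' * b ν μ μ ν) * h1'
  rcases indices_cases μ ν ρ σ hρσ with ⟨α, β, hαβ, hs⟩ | ⟨rfl, rfl⟩ | ⟨rfl, rfl⟩ | ⟨hμν, h4⟩
  · rw [hb.eq_zero_of_sign ⟨α, β, hαβ, hs⟩, hb.eq_zero_of_sign ⟨α, β, hαβ, by rw [← hs]; ring⟩,
      neg_zero]
  · exact hpair μ ν
  · rw [hpair ν μ, neg_neg]
  · obtain ⟨hμρ, hμσ, hνρ, hνσ⟩ := h4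
    obtain ⟨c, s, s', h1, h2, hΛ⟩ := exists_isLorentz_mix hμν
    have h3 := hb _ hΛ μ ν ρ σ
    simp only [sum_mix_left hμν, sum_mix_right hμν, sum_mix_of_ne hμρ.symm hνρ.symm,
      sum_mix_of_ne hμσ.symm hνσ.symm, h0] at h3
    have h1' : (c : ℂ) ^ 2 - s * s' = 1 := by exact_mod_cast h1
    have h2' : (s : ℂ) * s' ≠ 0 := by exact_mod_cast h2
    apply mul_left_cancel₀ h2'
    linear_combination -h3 - b μ ν ρ σ * h1'

/-- A boost or rotation in the plane of ν and ρ fixes the axes μ and σ, while entries with equal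
middle indices vanish by parity, so the mixing argument for the first pair applies here too. -/
theorem IsInvariant₄.antisymm_middle (hb : IsInvariant₄ b) {μ ν ρ σ : Fin 4}
    (hμν : μ ≠ ν) (hμρ : μ ≠ ρ) (hμσ : μ ≠ σ) (hνρ : ν ≠ ρ) (hνσ : ν ≠ σ) (hρσ : ρ ≠ σ) :
    b μ ρ ν σ = -b μ ν ρ σ := by
  have h0 (ν : Fin 4) (hμν : μ ≠ ν) (hνσ : ν ≠ σ) : b μ ν ν σ = 0 := by
    rcases indices_cases μ ν ν σ hνσ with h0 | ⟨h1, _⟩ | ⟨h1, _⟩ | ⟨_, _, _, h1, _⟩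
    · exact hb.eq_zero_of_sign h0
    · exact absurd h1 hμν
    · exact absurd h1 hμσ
    · exact absurd rfl h1
  obtain ⟨c, s, s', h1, h2, hΛ⟩ := exists_isLorentz_mix hνρ
  have h3 := hb _ hΛ μ ν ρ σ
  simp only [sum_mix_left hνρ, sum_mix_right hνρ, sum_mix_of_ne hμν hμρ,
    sum_mix_of_ne hνσ.symm hρσ.symm, h0 ν hμν hνσ, h0 ρ hμρ hρσ] at h3
  have h1' : (c : ℂ) ^ 2 - s * s' = 1 := by exact_mod_cast h1
  have h2' : (s : ℂ) * s' ≠ 0 := by exact_mod_cast h2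
  apply mul_left_cancel₀ h2'
  linear_combination -h3 - b μ ν ρ σ * h1'

/-- An invariant tensor that is antisymmetric in the last two indices is symmetric under the
exchange of the pairs of indices. -/
theorem IsInvariant₄.pair_symm (hb : IsInvariant₄ b)
    (h : ∀ μ ν ρ σ, b μ ν σ ρ = -b μ ν ρ σ) (μ ν ρ σ : Fin 4) : b ρ σ μ ν = b μ ν ρ σ := by
  have h0 := hb.diagonal_eq_zero h
  have hl := hb.antisymm_left h
  have hr (x y z : Fin 4) : b x y z z = 0 := by
    linear_combination (1 / 2 : ℂ) * h x y z z
  by_cases hρσ : ρ = σ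
  · subst hρσ
    rw [h0, hr]
  rcases indices_cases μ ν ρ σ hρσ with ⟨α, β, hαβ, hs⟩ | ⟨rfl, rfl⟩ | ⟨rfl, rfl⟩ |
    ⟨hμν, hμρ, hμσ, hνρ, hνσ⟩
  · rw [hb.eq_zero_of_sign ⟨α, β, hαβ, hs⟩, hb.eq_zero_of_sign ⟨α, β, hαβ, by rw [← hs]; ring⟩]
  · rfl
  · rw [hl, h, neg_neg]
  -- On four distinct axes the three adjacent transpositions all change the sign, and exchanging the
  -- pairs is an even permutation.
  · rw [hb.antisymm_middle hμρ.symm hρσ hνρ.symm hμσ hμν hνσ.symm, h, hl,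
      hb.antisymm_middle hμν hμρ hμσ hνρ hνσ hρσ]
    ring

end RankFour

/-! ### The string-free part of the two-point obstructions -/

theorem weight_pos_of_stringFree {m : Op →₀ ℕ} (hm : StringFree m) (h0 : m ≠ 0) :
    0 < Finsupp.weight opDim m := by
  rw [Finsupp.weight_apply, Finsupp.sum]
  refine Finset.sum_pos (fun o ho => ?_) (Finsupp.support_nonempty_iff.2 h0)
  obtain ⟨μ, rfl⟩ := hm o ho
  have := Nat.pos_of_ne_zero (Finsupp.mem_support_iff.1 ho)
  simpa [opDim] using this

/-- The string-free part of a kernel of non-positive scaling dimension is undifferentiated. -/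
theorem deltaPart_ker_of_weight {p : OpAlg} {n : ℤ} (hp : IsWeightedHomogeneous opDim p n)
    (hn : n ≤ 0) (b : Base) (i j : Fin 3) :
    deltaPart (ker b i j p : Expr N d) = C (constantCoeff p) * X (.kernel b i j 0) := by
  conv_lhs => rw [← support_sum_monomial_coeff p]
  simp only [map_sum, ker_monomial, map_mul, deltaPart_C]
  rw [Finset.sum_eq_single 0]
  · rw [deltaPart_kernel _ _ _ stringFree_zero, constantCoeff_eq]
  · intro m hm h0
    rw [deltaPart_kernel_string, mul_zero]
    intro hs
    have h1 := weight_pos_of_stringFree hs h0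
    rw [hp (mem_support_iff.1 hm)] at h1
    omega
  · intro h
    rw [notMem_support_iff.1 h, C_0, zero_mul]

theorem constantCoeff_of_weight_neg {p : OpAlg} {n : ℤ} (hp : IsWeightedHomogeneous opDim p n)
    (hn : n < 0) : constantCoeff p = 0 := by
  by_contra h
  have h1 := hp (d := 0) (by rwa [constantCoeff_eq] at h)
  rw [map_zero] at h1
  omega

/-- Operators transform linearly and without constant terms, so covariance passes to the constant
terms of the obstructions, which become invariant tensors. -/
theorem constantCoeff_opLorentz (Λ : Matrix (Fin 4) (Fin 4) ℝ) (p : OpAlg) :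
    constantCoeff (opLorentz Λ p) = constantCoeff p := by
  have : (constantCoeff : OpAlg →+* ℂ).comp (opLorentz Λ : OpAlg →+* OpAlg) = constantCoeff := by
    apply MvPolynomial.ringHom_ext
    · intro c
      rw [RingHom.comp_apply]
      congr 1
      exact (opLorentz Λ).commutes c
    · intro o
      rw [RingHom.comp_apply]
      have h : (opLorentz Λ : OpAlg →+* OpAlg) (X o) = opLorentz Λ (X o) := rfl
      rw [h, opLorentz, aeval_X]
      cases o <;> simp [dd, II, KK]
  exact DFunLike.congr_fun this p

theorem sum_lorentz_A (Λ : Matrix (Fin 4) (Fin 4) ℝ) (ν : Fin 4) (g : Species → ℂ) :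
    ∑ φ : Species, φ.lorentz Λ (.A ν) * g φ = ∑ ν', (Λ ν' ν : ℂ) * g (.A ν') := by
  symm
  apply Fintype.sum_of_injective Species.A (fun _ _ h => Species.A.inj h)
  · rintro (_ | ν' | _) h
    · simp [Species.lorentz]
    · exact absurd ⟨ν', rfl⟩ h
    · simp [Species.lorentz]
  · intro ν'
    rfl

theorem sum_lorentz_F (Λ : Matrix (Fin 4) (Fin 4) ℝ) (ρ σ : Fin 4) (g : Species → ℂ) :
    ∑ φ : Species, φ.lorentz Λ (.F ρ σ) * g φ
      = ∑ ρ', (Λ ρ' ρ : ℂ) * ∑ σ', (Λ σ' σ : ℂ) * g (.F ρ' σ') := by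
  simp only [Finset.mul_sum]
  rw [← Fintype.sum_prod_type']
  symm
  apply Fintype.sum_of_injective (fun x : Fin 4 × Fin 4 => Species.F x.1 x.2)
    (fun x y h => Prod.ext (Species.F.inj h).1 (Species.F.inj h).2)
  · rintro (_ | _ | ⟨ρ', σ'⟩) h
    · simp [Species.lorentz]
    · simp [Species.lorentz]
    · exact absurd ⟨(ρ', σ'), rfl⟩ h
  · intro x
    rw [Species.lorentz, mul_assoc]

/-! ### Constant terms of the two-point obstructions. -/

section Constants

variable {cF : ℝ} (P : GluonOrdering cF)

/-- The constant term of the two-point obstruction. -/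
noncomputable def obsConst (μ : Fin 4) (φ χ : Species) : ℂ := constantCoeff (P.o μ φ χ)

theorem obsConst_covariant {Λ : Matrix (Fin 4) (Fin 4) ℝ} (hΛ : IsLorentz Λ) (μ : Fin 4)
    (φ χ : Species) : obsConst P μ φ χ = ∑ μ', (Λ μ' μ : ℂ) * ∑ φ' : Species, φ'.lorentz Λ φ *
      ∑ χ' : Species, χ'.lorentz Λ χ * obsConst P μ' φ' χ' := by
  have h := congrArg constantCoeff (P.covariant Λ hΛ μ φ χ)
  rw [constantCoeff_opLorentz] at h
  rw [obsConst, h]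
  simp only [map_sum, map_mul, constantCoeff_C, obsConst, Finset.mul_sum, mul_assoc]

theorem isInvariant_AF : IsInvariant₄ (fun μ ν ρ σ => obsConst P μ (.A ν) (.F ρ σ)) := by
  intro Λ hΛ μ ν ρ σ
  dsimp only
  rw [obsConst_covariant P hΛ]
  simp only [sum_lorentz_A, sum_lorentz_F]

theorem isInvariant_FA : IsInvariant₄ (fun μ ν ρ σ => obsConst P μ (.F ν ρ) (.A σ)) := by
  intro Λ hΛ μ ν ρ σ
  dsimp only
  rw [obsConst_covariant P hΛ]
  simp only [sum_lorentz_A, sum_lorentz_F]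

/-- The dimension 1 + 1 + 1 - 4 = -1 leaves no room for a constant. -/
theorem obsConst_AA (μ ν l : Fin 4) : obsConst P μ (.A ν) (.A l) = 0 :=
  constantCoeff_of_weight_neg (P.scaling μ (.A ν) (.A l)) (by norm_num [Species.dim])

theorem obsConst_AF_antisymm_right (μ ν ρ σ : Fin 4) :
    obsConst P μ (.A ν) (.F σ ρ) = -obsConst P μ (.A ν) (.F ρ σ) := by
  rw [obsConst, P.antisymm_right, map_neg, obsConst]

theorem obsConst_AF_antisymm_left (μ ν ρ σ : Fin 4) :
    obsConst P ν (.A μ) (.F ρ σ) = -obsConst P μ (.A ν) (.F ρ σ) :=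
  (isInvariant_AF P).antisymm_left (obsConst_AF_antisymm_right P) μ ν ρ σ

theorem obsConst_AF_pair_symm (μ ν ρ σ : Fin 4) :
    obsConst P ρ (.A σ) (.F μ ν) = obsConst P μ (.A ν) (.F ρ σ) :=
  (isInvariant_AF P).pair_symm (obsConst_AF_antisymm_right P) μ ν ρ σ

theorem exists_obsConst_FA : ∃ κ : ℂ, ∀ ν l : Fin 4,
    ∑ μ, sg μ * obsConst P μ (.F μ ν) (.A l) = κ * eta ν l :=
  ⟨_, (isInvariant_FA P).contract.eq_eta⟩

theorem gluonObs_X (i k : Fin 3) (μ : Fin 4) (φ χ : Species) (a b : Fin N)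
    (h : φ.dim + χ.dim + 1 - 4 ≤ 0) :
    gluonObs P i k μ φ a (X (.field k χ b 0) : Expr N d)
      = if a = b then C (Complex.I * obsConst P μ φ χ) * delta i k else 0 := by
  rw [gluonObs, mkDerivation_X]
  dsimp only
  rw [deltaPart_ker_of_weight (P.scaling μ φ χ) h, ← delta_eq_X, ← mul_assoc, ← C_mul, obsConst]

theorem gluonObs_w (i k : Fin 3) (μ : Fin 4) (a : Fin N) (Z : Expr N d) :
    gluonObs P i k μ .w a Z = 0 := by
  refine derivation_eq_zero (s := Set.univ) (fun g _ => ?_) (by rw [supported_univ]; trivial)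
  rw [gluonObs, mkDerivation_X]
  cases g <;> dsimp only
  split_ifs
  · rw [P.kinematic_w, map_zero, map_zero, mul_zero]
  · rfl

theorem gluonObs_A_A (i k : Fin 3) (μ ν l : Fin 4) (a b : Fin N) :
    gluonObs P i k μ (.A ν) a (A k l b : Expr N d) = 0 := by
  rw [A, gluonObs_X _ _ _ _ _ _ _ _ (by norm_num [Species.dim]), obsConst_AA, mul_zero, C_0,
    zero_mul, ite_self]

theorem gluonObs_j (G : GaugeData N d) (i k : Fin 3) (μ ν : Fin 4) (φ : Species) (a b : Fin N) :
    gluonObs P i k μ φ a (j G k ν b) = 0 := by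
  refine derivation_eq_zero (s := {g | ∃ m n, g = .quark k k m n 0 0}) ?_ ?_
  · rintro _ ⟨m, n, rfl⟩
    rw [gluonObs, mkDerivation_X]
  · refine sum_mem fun s _ => sum_mem fun t _ => sum_mem fun r _ => sum_mem fun r' _ =>
      mul_mem (Subalgebra.algebraMap_mem _ _) (X_mem_supported.2 ⟨_, _, rfl⟩)

end Constants

/-! ### Membership of colour products -/

section Membership

variable (G : GaugeData N d) {S : Subalgebra ℂ (Expr N d)} {U V : Fin N → Expr N d}

theorem inn_mem (hU : ∀ a, U a ∈ S) (hV : ∀ a, V a ∈ S) : inn U V ∈ S :=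
  sum_mem fun a _ => mul_mem (hU a) (hV a)

theorem brk_mem (hU : ∀ a, U a ∈ S) (hV : ∀ a, V a ∈ S) (c : Fin N) : brk G U V c ∈ S :=
  neg_mem (sum_mem fun a _ => sum_mem fun b _ =>
    mul_mem (mul_mem (Subalgebra.algebraMap_mem _ _) (hU a)) (hV b))

theorem map_inn (φ : Expr N d →ₐ[ℂ] Expr N d) (U V : Fin N → Expr N d) :
    φ (inn U V) = inn (fun a => φ (U a)) (fun a => φ (V a)) := by
  simp only [inn, map_sum, map_mul]

theorem map_brk (φ : Expr N d →ₐ[ℂ] Expr N d) (U V : Fin N → Expr N d) (c : Fin N) :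
    φ (brk G U V c) = brk G (fun a => φ (U a)) (fun a => φ (V a)) c := by
  have h (x : ℂ) : φ (C x) = C x := φ.commutes x
  simp only [brk, map_neg, map_sum, map_mul, h]

theorem field_mem_wick (i : Fin 3) (φ : Species) (a : Fin N) :
    (X (.field i φ a 0) : Expr N d) ∈ wick i 0 :=
  X_mem_supported.2 ⟨rfl, by simp⟩

theorem j_mem_wick (i : Fin 3) (μ : Fin 4) (a : Fin N) : j G i μ a ∈ wick i 0 :=
  sum_mem fun s _ => sum_mem fun t _ => sum_mem fun r _ => sum_mem fun r' _ =>
    mul_mem (C_mem _ _) (X_mem_supported.2 ⟨rfl, rfl, by simp⟩)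

theorem L1_mem_wick (i : Fin 3) : L1 G i ∈ wick i 0 :=
  add_mem (mul_mem (C_mem _ _) (sum_mem fun _ _ => sum_mem fun _ _ => mul_mem (C_mem _ _)
    (inn_mem (fun _ => field_mem_wick _ _ _)
      (brk_mem G (fun _ => field_mem_wick _ _ _) (fun _ => field_mem_wick _ _ _)))))
    (sum_mem fun _ _ => inn_mem (fun _ => field_mem_wick _ _ _) (j_mem_wick G i _))

theorem Q1_mem_wick (i : Fin 3) (μ : Fin 4) : Q1 G i μ ∈ wick i 0 :=
  add_mem (sum_mem fun _ _ => mul_mem (C_mem _ _)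
    (inn_mem (fun _ => field_mem_wick _ _ _)
      (brk_mem G (fun _ => field_mem_wick _ _ _) (fun _ => field_mem_wick _ _ _))))
    (inn_mem (fun _ => field_mem_wick _ _ _) (j_mem_wick G i _))

theorem L2_mem_potentials (cF : ℝ) (i : Fin 3) : L2 G cF i ∈ potentials i := by
  have h (μ : Fin 4) (a : Fin N) : (A i μ a : Expr N d) ∈ potentials i :=
    X_mem_supported.2 ⟨μ, a, rfl⟩
  exact mul_mem (C_mem _ _) (sum_mem fun _ _ => sum_mem fun _ _ => mul_mem (C_mem _ _)
    (inn_mem (brk_mem G (h _) (h _)) (brk_mem G (h _) (h _))))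

/-- The coefficient of the undifferentiated delta function in `Q_2`. -/
noncomputable def Q2local (cF : ℝ) (i : Fin 3) (μ : Fin 4) : Expr N d :=
  C (-2 * (1 + (cF : ℂ)))
    * ∑ ν, C (sg μ * sg ν) * inn (brk G (A i μ) (A i ν)) (brk G (w i) (A i ν))

theorem Q2local_mem_wick (cF : ℝ) (i : Fin 3) (μ : Fin 4) : Q2local G cF i μ ∈ wick i 0 :=
  mul_mem (C_mem _ _) (sum_mem fun _ _ => mul_mem (C_mem _ _)
    (inn_mem (brk_mem G (fun _ => field_mem_wick _ _ _) (fun _ => field_mem_wick _ _ _))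
      (brk_mem G (fun _ => field_mem_wick _ _ _) (fun _ => field_mem_wick _ _ _))))

theorem deltaPart_w2 (i k : Fin 3) (a : Fin N) : deltaPart (w2 G i k a) = 0 := by
  have h (ν : Fin 4) : deltaPart (ker .delta i k (II false ν) : Expr N d) = 0 := by
    rw [II, X, ker_monomial, map_mul, deltaPart_kernel_string, mul_zero]
    intro hs
    obtain ⟨μ, hμ⟩ := hs (Op.I false ν) (by simp)
    exact Op.noConfusion hμ
  simp only [w2, map_sum, map_mul, h, mul_zero, Finset.sum_const_zero]

theorem deltaPart_Q2 (cF : ℝ) (i k : Fin 3) (μ : Fin 4) :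
    deltaPart (Q2 G cF i k μ) = Q2local G cF i μ * delta i k := by
  have h1 := deltaPart_of_mem_wick (Q2local_mem_wick G cF i μ)
  rw [Q2, map_add, ← Q2local, map_mul, h1, deltaPart_delta, map_mul, map_inn]
  simp only [deltaPart_w2, inn, mul_zero, Finset.sum_const_zero, add_zero]

/-- Brackets of fields may be moved on the support of the delta function. -/
theorem brk_field_sub_mul_delta_mem {i k : Fin 3} (hik : i ≠ k) (φ χ : Species) (a : Fin N) :
    (brk G (fun b => X (.field i φ b 0)) (fun b => X (.field i χ b 0)) a
      - brk G (fun b => X (.field k φ b 0)) (fun b => X (.field k χ b 0)) a) * delta i k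
      ∈ (supportIdeal : Ideal (Expr N d)) := by
  have h := sub_rename_mul_delta_mem hik
    (Z := brk G (fun b => X (.field i φ b 0)) (fun b => X (.field i χ b 0)) a)
    (brk_mem G (S := supported ℂ {g | g.NotLinking i k}) (fun _ => X_mem_supported.2 (by trivial))
      (fun _ => X_mem_supported.2 (by trivial)) a)
  rw [map_brk] at h
  simpa only [rename_X, Gen.map, Function.update_self] using h

theorem derivation_mem_ideal {ι : Type*} {s : Set ι} {J : Ideal (MvPolynomial ι ℂ)}
    {D : Derivation ℂ (MvPolynomial ι ℂ) (MvPolynomial ι ℂ)}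
    (h : ∀ g ∈ s, D (X g) ∈ J) {Z : MvPolynomial ι ℂ} (hZ : Z ∈ supported ℂ s) : D Z ∈ J := by
  refine supported_induction (p := fun Z => D Z ∈ J) h
    (fun c => by rw [derivation_C]; exact J.zero_mem)
    (fun Y Z hY hZ => by rw [map_add]; exact J.add_mem hY hZ)
    (fun Y Z hY hZ => ?_) hZ
  rw [derivation_mul]
  exact J.add_mem (J.mul_mem_left _ hZ) (J.mul_mem_left _ hY)

end Membership

/-! ### The obstruction of `L_2` -/

theorem inn_zero_left (V : Fin N → Expr N d) : inn 0 V = 0 := by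
  simp only [inn, Pi.zero_apply, zero_mul, Finset.sum_const_zero]

theorem inn_zero_right (V : Fin N → Expr N d) : inn V 0 = 0 := by
  rw [inn_comm, inn_zero_left]

theorem brk_zero_left (G : GaugeData N d) (V : Fin N → Expr N d) : brk G 0 V = 0 := by
  funext c
  simp only [brk, Pi.zero_apply, mul_zero, zero_mul, Finset.sum_const_zero, neg_zero]

theorem brk_zero_right (G : GaugeData N d) (V : Fin N → Expr N d) : brk G V 0 = 0 := by
  rw [brk_swap, brk_zero_left, neg_zero]

/-- The infinitesimal gauge rotation of the potential by `w`. -/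
noncomputable def gaugeRotation (G : GaugeData N d) (k : Fin 3) :
    Derivation ℂ (Expr N d) (Expr N d) :=
  mkDerivation ℂ (fun g => match g with
    | .field _ (.A μ) a _ => brk G (w k) (A k μ) a
    | _ => 0)

theorem derivation_C_mul (D : Derivation ℂ (Expr N d) (Expr N d)) (c : ℂ) (Z : Expr N d) :
    D (C c * Z) = C c * D Z := by
  rw [← smul_eq_C_mul, ← smul_eq_C_mul, D.map_smul]

theorem derivation_sum_apply {ι : Type*} (s : Finset ι)
    (D : ι → Derivation ℂ (Expr N d) (Expr N d)) (Z : Expr N d) :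
    (∑ i ∈ s, D i) Z = ∑ i ∈ s, D i Z := by
  classical
  induction s using Finset.induction_on with
  | empty => rfl
  | insert i s hi ih => rw [Finset.sum_insert hi, Finset.sum_insert hi, Derivation.add_apply, ih]

/-- By Jacobi the rotation acts on i[A_μ, A_ν] as the bracket with w, and the invariant inner
product of a vector with its own rotation is zero. -/
theorem gaugeRotation_L2 (G : GaugeData N d) (cF : ℝ) (k : Fin 3) :
    gaugeRotation G k (L2 G cF k) = 0 := by
  have hA (μ : Fin 4) : (fun a => gaugeRotation G k (A k μ a)) = brk G (w k) (A k μ) := by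
    funext a
    exact mkDerivation_X _ _ _
  have hB (μ ν : Fin 4) : gaugeRotation G k
      (inn (brk G (A k μ) (A k ν)) (brk G (A k μ) (A k ν))) = 0 := by
    rw [derivation_inn, derivation_brk, hA, hA, ← brk_jacobi, inn_brk_self, inn_comm,
      inn_brk_self, add_zero]
  rw [L2, derivation_C_mul]
  simp only [map_sum, derivation_C_mul, hB, mul_zero, Finset.sum_const_zero]

section Local

variable {cF : ℝ} {G : GaugeData N d} (P : GluonOrdering cF) (R : QuarkOrdering G)

/-- Against potentials only the factor F of `Q1` contributes: w is kinematic, O(A,A) has no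
string-free part, and the current does not contract with A. -/
theorem deltaPart_obs_Q1 {i k : Fin 3} (hik : k ≠ i) {Z : Expr N d} (hZ : Z ∈ potentials k) :
    deltaPart (obs P R i (Q1 G i) Z) = ∑ μ, ∑ ν, ∑ a,
      C (sg μ * sg ν) * brk G (w i) (A i ν) a * gluonObs P i k μ (.F μ ν) a Z := by
  have hZ' := potentials_le_wick k hZ
  rw [deltaPart_obs P R hik (Q1_mem_wick G i) hZ']
  refine Finset.sum_congr rfl fun μ _ => ?_
  have hw : (fun a => localObs P R i μ Z (w i a)) = 0 := by
    funext a
    rw [w, localObs_field P R hik μ _ a hZ', gluonObs_w, Pi.zero_apply]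
  have hA (ν : Fin 4) : (fun a => localObs P R i μ Z (A i ν a)) = 0 := by
    funext a
    rw [A, localObs_field P R hik μ _ a hZ']
    refine derivation_eq_zero ?_ hZ
    rintro _ ⟨l, b, rfl⟩
    exact gluonObs_A_A P i k μ ν l a b
  have hF (ν : Fin 4) (a : Fin N) :
      localObs P R i μ Z (F i μ ν a) = gluonObs P i k μ (.F μ ν) a Z := by
    rw [F, localObs_field P R hik μ _ a hZ']
  have hj : (fun a => localObs P R i μ Z (j G i μ a)) = 0 := by
    funext a
    simp only [j, map_sum, derivation_C_mul, localObs_quark P R i k μ _ _ hZ, mul_zero,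
      Finset.sum_const_zero, Pi.zero_apply]
  rw [Q1, map_add, derivation_inn, hw, hj, inn_zero_left, inn_zero_right, add_zero, add_zero,
    map_sum]
  refine Finset.sum_congr rfl fun ν _ => ?_
  rw [derivation_C_mul, derivation_inn, derivation_brk, hw, hA, brk_zero_left, brk_zero_right,
    add_zero, inn_zero_right, add_zero, inn, Finset.mul_sum]
  refine Finset.sum_congr rfl fun a _ => ?_
  rw [hF]
  ring

theorem deltaPart_obs_Q1_L2_mem {i k : Fin 3} (hik : i ≠ k) :
    deltaPart (obs P R i (Q1 G i) (L2 G cF k)) ∈ (supportIdeal : Ideal (Expr N d)) := by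
  obtain ⟨κ, hκ⟩ := exists_obsConst_FA P
  rw [deltaPart_obs_Q1 P R hik.symm (L2_mem_potentials G cF k)]
  -- As a function of the second argument the obstruction is again a derivation, so it suffices to
  -- compare it with the gauge rotation on the potentials.
  let E : Derivation ℂ (Expr N d) (Expr N d) := ∑ μ, ∑ ν, ∑ a,
    (C (sg μ * sg ν) * brk G (w i) (A i ν) a) • gluonObs P i k μ (.F μ ν) a
  have hE (Z : Expr N d) : E Z = ∑ μ, ∑ ν, ∑ a,
      C (sg μ * sg ν) * brk G (w i) (A i ν) a * gluonObs P i k μ (.F μ ν) a Z := by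
    simp only [E, derivation_sum_apply, Derivation.smul_apply, smul_eq_mul]
  have hEA (l : Fin 4) (b : Fin N) :
      E (A k l b) = C (Complex.I * κ) * (brk G (w i) (A i l) b * delta i k) := by
    have h1 (μ ν : Fin 4) (a : Fin N) : gluonObs P i k μ (.F μ ν) a (A k l b : Expr N d)
        = if a = b then C (Complex.I * obsConst P μ (.F μ ν) (.A l)) * delta i k else 0 :=
      gluonObs_X P i k μ _ _ a b (by norm_num [Species.dim])
    have h2 (ν : Fin 4) : ∑ μ, C (sg μ * sg ν) * brk G (w i) (A i ν) b
          * (C (Complex.I * obsConst P μ (.F μ ν) (.A l)) * delta i k)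
        = C (Complex.I * (sg ν * (κ * eta ν l))) * (brk G (w i) (A i ν) b * delta i k) := by
      rw [← hκ, Finset.mul_sum, Finset.mul_sum, map_sum, Finset.sum_mul]
      refine Finset.sum_congr rfl fun μ _ => ?_
      simp only [C_mul]
      ring
    have h3 : sg l * (κ * sg l) = κ := by
      rw [sg]; split_ifs <;> ring
    rw [hE]
    simp only [h1, mul_ite, mul_zero, Finset.sum_ite_eq', Finset.mem_univ, if_true]
    rw [Finset.sum_comm]
    simp only [h2, eta, mul_ite, mul_zero]
    rw [Finset.sum_eq_single l]
    · rw [if_pos rfl, h3]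
    · intro ν _ hν
      rw [if_neg hν, C_0, zero_mul]
    · exact fun h => absurd (Finset.mem_univ l) h
  -- The two derivations differ on each potential only by moving [w, A_l] from x_k to x_i on the
  -- support of δ.
  have hmem := derivation_mem_ideal (J := supportIdeal)
    (D := E - (C (Complex.I * κ) * delta i k : Expr N d) • gaugeRotation G k) ?_
    (L2_mem_potentials G cF k)
  · rw [Derivation.sub_apply, Derivation.smul_apply, gaugeRotation_L2, smul_zero, sub_zero,
      hE] at hmem
    exact hmem
  · rintro _ ⟨l, b, rfl⟩
    have h0 : (brk G (w i) (A i l) b - brk G (w k) (A k l) b) * delta i k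
        ∈ (supportIdeal : Ideal (Expr N d)) := brk_field_sub_mul_delta_mem G hik .w (.A l) b
    have h := Ideal.mul_mem_left _ (C (Complex.I * κ)) h0
    have h1 : gaugeRotation G k (A k l b) = brk G (w k) (A k l) b := mkDerivation_X _ _ _
    convert h using 1
    rw [← A, Derivation.sub_apply, Derivation.smul_apply, hEA, h1, smul_eq_mul]
    ring

/-! ### The obstruction of the local part of `Q_2` -/

theorem gluonObs_A_L1 (i k : Fin 3) (μ ν : Fin 4) (a : Fin N) :
    gluonObs P i k μ (.A ν) a (L1 G k) = C (1 / 2 : ℂ) * ∑ ρ, ∑ σ,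
      C (sg ρ * sg σ * (Complex.I * obsConst P μ (.A ν) (.F ρ σ)))
        * (brk G (A k ρ) (A k σ) a * delta i k) := by
  set D : Derivation ℂ (Expr N d) (Expr N d) := gluonObs P i k μ (.A ν) a with hD
  have hA (l : Fin 4) : (fun b => D (A k l b)) = 0 := by
    funext b
    exact gluonObs_A_A P i k μ ν l a b
  have hj (l : Fin 4) : (fun b => D (j G k l b)) = 0 := by
    funext b
    exact gluonObs_j P G i k μ l _ a b
  have hF (ρ σ : Fin 4) (B : Fin N → Expr N d) : inn (fun b => D (F k ρ σ b)) B
      = C (Complex.I * obsConst P μ (.A ν) (.F ρ σ)) * (B a * delta i k) := by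
    have h1 (b : Fin N) : D (F k ρ σ b)
        = if a = b then C (Complex.I * obsConst P μ (.A ν) (.F ρ σ)) * delta i k else 0 :=
      gluonObs_X P i k μ _ _ a b (by norm_num [Species.dim])
    simp only [inn, h1, ite_mul, zero_mul, Finset.sum_ite_eq, Finset.mem_univ, if_true]
    ring
  rw [L1, map_add, derivation_C_mul, map_sum, map_sum]
  simp only [map_sum, derivation_C_mul, derivation_inn, derivation_brk, hA, hj, hF, brk_zero_left,
    brk_zero_right, inn_zero_left, inn_zero_right, add_zero, Finset.sum_const_zero]
  simp only [← mul_assoc, ← C_mul]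

/-- The terms (μ,ν) and (ν,μ) are paired for an antisymmetric variation H of A. Two of the four
terms each give -1 times the right-hand inner product by invariance; the other two combine to a
third by Jacobi. -/
theorem inn_variation_add_swap (H : Fin N → Expr N d) (i : Fin 3) (μ ν : Fin 4) :
    (inn (brk G (A i μ) H) (brk G (w i) (A i ν)) + inn (brk G (A i μ) (A i ν)) (brk G (w i) H))
      + (inn (brk G (A i ν) (-H)) (brk G (w i) (A i μ))
        + inn (brk G (A i ν) (A i μ)) (brk G (w i) (-H)))
      = -3 * inn H (brk G (w i) (brk G (A i μ) (A i ν))) := by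
  have h1 : inn (brk G (A i μ) H) (brk G (w i) (A i ν))
      = inn H (brk G (brk G (w i) (A i ν)) (A i μ)) := by
    rw [inn_comm, inn_brk_cycle, inn_brk_cycle]
  have h2 : inn (brk G (A i ν) (-H)) (brk G (w i) (A i μ))
      = -inn H (brk G (brk G (w i) (A i μ)) (A i ν)) := by
    rw [inn_comm, inn_brk_cycle, inn_brk_cycle, inn_neg_left]
  have h3 : inn (brk G (A i μ) (A i ν)) (brk G (w i) H)
      = -inn H (brk G (w i) (brk G (A i μ) (A i ν))) := by
    rw [← inn_neg_right, ← brk_swap, inn_brk_cycle, inn_brk_cycle]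
  have h4 : inn (brk G (A i ν) (A i μ)) (brk G (w i) (-H))
      = -inn H (brk G (w i) (brk G (A i μ) (A i ν))) := by
    rw [brk_swap, brk_neg_right, inn_neg_left, inn_neg_right, neg_neg, h3]
  have h5 : inn H (brk G (w i) (brk G (A i μ) (A i ν)))
      = inn H (brk G (brk G (w i) (A i μ)) (A i ν))
        - inn H (brk G (brk G (w i) (A i ν)) (A i μ)) := by
    rw [brk_jacobi, inn_add_right, brk_swap G (brk G (w i) (A i ν)), inn_neg_right, sub_eq_add_neg]
  rw [h1, h2, h3, h4]
  linear_combination h5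

theorem sum_half_add_swap (X : Fin 4 → Fin 4 → Expr N d) :
    ∑ μ, ∑ ν, X μ ν = C (1 / 2) * ∑ μ, ∑ ν, (X μ ν + X ν μ) := by
  have h1 : ∑ μ, ∑ ν, X ν μ = ∑ μ, ∑ ν, X μ ν := Finset.sum_comm
  have h2 : (C (1 / 2) * 2 : Expr N d) = 1 := by
    rw [show (2 : Expr N d) = C 2 from (map_ofNat C 2).symm, ← C_mul]
    norm_num
  simp only [Finset.sum_add_distrib, h1]
  linear_combination (-(∑ μ, ∑ ν, X μ ν)) * h2

theorem sum_eq_zero_of_pair_antisymm {f : Fin 4 → Fin 4 → Fin 4 → Fin 4 → Expr N d}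
    (h : ∀ μ ν ρ σ, f ρ σ μ ν = -f μ ν ρ σ) : ∑ μ, ∑ ν, ∑ ρ, ∑ σ, f μ ν ρ σ = 0 := by
  have h1 : ∑ x : Fin 4 × Fin 4, ∑ y : Fin 4 × Fin 4, f x.1 x.2 y.1 y.2
      = ∑ x : Fin 4 × Fin 4, ∑ y : Fin 4 × Fin 4, f y.1 y.2 x.1 x.2 := Finset.sum_comm
  have h2 : ∑ x : Fin 4 × Fin 4, ∑ y : Fin 4 × Fin 4, f y.1 y.2 x.1 x.2
      = ∑ x : Fin 4 × Fin 4, ∑ y : Fin 4 × Fin 4, -f x.1 x.2 y.1 y.2 :=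
    Finset.sum_congr rfl fun x _ => Finset.sum_congr rfl fun y _ => h x.1 x.2 y.1 y.2
  rw [h2] at h1
  simp only [Finset.sum_neg_distrib, Fintype.sum_prod_type] at h1
  exact self_eq_neg.1 h1

theorem deltaPart_obs_Q2local {i k : Fin 3} (hik : k ≠ i) :
    deltaPart (obs P R i (Q2local G cF i) (L1 G k))
      = C (-2 * (1 + (cF : ℂ))) * (C (1 / 2) * ∑ μ, ∑ ν, C (sg μ * sg ν)
        * (-3 * inn (fun a => gluonObs P i k μ (.A ν) a (L1 G k))
            (brk G (w i) (brk G (A i μ) (A i ν))))) := by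
  have hZ := L1_mem_wick G k
  let H (μ ν : Fin 4) (a : Fin N) : Expr N d := gluonObs P i k μ (.A ν) a (L1 G k)
  have hH (μ ν : Fin 4) : H ν μ = -H μ ν := by
    funext a
    simp only [H, Pi.neg_apply, gluonObs_A_L1, obsConst_AF_antisymm_left P μ ν, mul_neg, C_neg,
      neg_mul, Finset.sum_neg_distrib]
  have hH0 (μ : Fin 4) : H μ μ = 0 := self_eq_neg.1 (hH μ μ)
  have hw (μ : Fin 4) : (fun a => localObs P R i μ (L1 G k) (w i a)) = 0 := by
    funext a
    rw [w, localObs_field P R hik μ _ a hZ, gluonObs_w, Pi.zero_apply]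
  have hA (μ ν : Fin 4) : (fun a => localObs P R i μ (L1 G k) (A i ν a)) = H μ ν := by
    funext a
    rw [A, localObs_field P R hik μ _ a hZ]
  rw [deltaPart_obs P R hik (Q2local_mem_wick G cF i) hZ]
  simp only [Q2local, derivation_C_mul, map_sum, derivation_inn, derivation_brk, hw, hA, hH0,
    brk_zero_left, zero_add]
  rw [← Finset.mul_sum, sum_half_add_swap]
  refine congrArg (fun Z => C (-2 * (1 + (cF : ℂ))) * (C (1 / 2) * Z)) ?_
  refine Finset.sum_congr rfl fun μ _ => Finset.sum_congr rfl fun ν _ => ?_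
  have h := inn_variation_add_swap (G := G) (H μ ν) i μ ν
  rw [← hH] at h
  rw [← h, mul_comm (sg ν)]
  ring

/-- The coefficient tensor is symmetric under exchange of the pairs μν and ρσ, whereas ⟨[A_ρ,A_σ] |
[w,[A_μ,A_ν]]⟩ is antisymmetric because the bracket with w is skew for the inner product. -/
theorem deltaPart_obs_Q2local_mem {i k : Fin 3} (hik : i ≠ k) :
    deltaPart (obs P R i (Q2local G cF i) (L1 G k)) ∈ (supportIdeal : Ideal (Expr N d)) := by
  let B (μ ν : Fin 4) : Fin N → Expr N d := brk G (w i) (brk G (A i μ) (A i ν))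
  let b (μ ν ρ σ : Fin 4) : ℂ :=
    sg μ * sg ν * (sg ρ * sg σ) * (Complex.I * obsConst P μ (.A ν) (.F ρ σ))
  have hb (μ ν ρ σ : Fin 4) : b ρ σ μ ν = b μ ν ρ σ := by
    simp only [b, obsConst_AF_pair_symm P μ ν ρ σ]
    ring
  have hB (μ ν ρ σ : Fin 4) :
      inn (brk G (A i μ) (A i ν)) (B ρ σ) = -inn (brk G (A i ρ) (A i σ)) (B μ ν) := by
    simp only [B]
    rw [← inn_neg_right, ← brk_swap, inn_brk_cycle, inn_brk_cycle]
  have hzero : ∑ μ, ∑ ν, ∑ ρ, ∑ σ, C (b μ ν ρ σ) * inn (brk G (A i ρ) (A i σ)) (B μ ν)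
      = (0 : Expr N d) := by
    apply sum_eq_zero_of_pair_antisymm
    intro μ ν ρ σ
    rw [hb, hB, mul_neg]
  have hexp (μ ν : Fin 4) : C (sg μ * sg ν)
      * inn (fun a => gluonObs P i k μ (.A ν) a (L1 G k)) (B μ ν)
      = C (1 / 2) * ∑ ρ, ∑ σ, C (b μ ν ρ σ) * (inn (brk G (A k ρ) (A k σ)) (B μ ν) * delta i k) := by
    simp only [inn, gluonObs_A_L1, Finset.mul_sum, Finset.sum_mul]
    rw [Finset.sum_comm]
    refine Finset.sum_congr rfl fun ρ _ => ?_
    rw [Finset.sum_comm]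
    refine Finset.sum_congr rfl fun σ _ => Finset.sum_congr rfl fun a _ => ?_
    simp only [b, C_mul]
    ring
  -- The cancellation `hzero` requires all potentials at the same point, so those coming from `L1`
  -- are first moved to x_i on the support of δ.
  have hmove (ρ σ : Fin 4) (V : Fin N → Expr N d) :
      inn (brk G (A i ρ) (A i σ)) V * delta i k - inn (brk G (A k ρ) (A k σ)) V * delta i k
      ∈ (supportIdeal : Ideal (Expr N d)) := by
    simp only [inn, Finset.sum_mul, ← Finset.sum_sub_distrib]
    refine sum_mem fun a _ => ?_
    have h0 : (brk G (A i ρ) (A i σ) a - brk G (A k ρ) (A k σ) a) * delta i k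
        ∈ (supportIdeal : Ideal (Expr N d)) := brk_field_sub_mul_delta_mem G hik (.A ρ) (.A σ) a
    convert Ideal.mul_mem_left _ (V a) h0 using 1
    ring
  have hmem : ∑ μ, ∑ ν, ∑ ρ, ∑ σ,
      C (b μ ν ρ σ) * (inn (brk G (A k ρ) (A k σ)) (B μ ν) * delta i k)
      ∈ (supportIdeal : Ideal (Expr N d)) := by
    have h1 : ∑ μ, ∑ ν, ∑ ρ, ∑ σ, C (b μ ν ρ σ) *
        (inn (brk G (A i ρ) (A i σ)) (B μ ν) * delta i k
          - inn (brk G (A k ρ) (A k σ)) (B μ ν) * delta i k)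
        ∈ (supportIdeal : Ideal (Expr N d)) :=
      sum_mem fun μ _ => sum_mem fun ν _ => sum_mem fun ρ _ => sum_mem fun σ _ =>
        Ideal.mul_mem_left _ _ (hmove ρ σ (B μ ν))
    simp only [mul_sub, Finset.sum_sub_distrib, ← mul_assoc, ← Finset.sum_mul, hzero, zero_mul,
      zero_sub, neg_mem_iff] at h1
    simpa only [← mul_assoc, ← Finset.sum_mul] using h1
  rw [deltaPart_obs_Q2local P R hik.symm]
  refine Ideal.mul_mem_left _ _ (Ideal.mul_mem_left _ _ ?_)
  have h2 : ∑ μ, ∑ ν, C (sg μ * sg ν)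
        * (-3 * inn (fun a => gluonObs P i k μ (.A ν) a (L1 G k))
            (brk G (w i) (brk G (A i μ) (A i ν))))
      = -3 * (C (1 / 2) * ∑ μ, ∑ ν, ∑ ρ, ∑ σ,
        C (b μ ν ρ σ) * (inn (brk G (A k ρ) (A k σ)) (B μ ν) * delta i k)) := by
    rw [Finset.mul_sum, Finset.mul_sum]
    refine Finset.sum_congr rfl fun μ _ => ?_
    rw [Finset.mul_sum, Finset.mul_sum]
    refine Finset.sum_congr rfl fun ν _ => ?_
    rw [← hexp]
    ring
  rw [h2]
  exact Ideal.mul_mem_left _ _ (Ideal.mul_mem_left _ _ hmem)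

/-- The local part of the third-order obstruction vanishes by the support properties. -/
theorem O3loc_mem {P : GluonOrdering cF} {R : QuarkOrdering G} (B : BilocalOrdering P R) :
    O3loc B ∈ (supportIdeal : Ideal (Expr N d)) := by
  rw [O3loc, symm3_add]
  refine add_mem (symm3_mem_of_relabel_mem fun σ => relabel_mem_supportIdeal σ ?_) ?_
  · exact Ideal.mul_mem_right _ _ (deltaPart_obs_Q1_L2_mem P R (by decide))
  · simp only [deltaPart_Q2]
    exact symm3_deltaPart_obs2_mem B (Q2local_mem_wick G cF 0) (L1_mem_wick G 2)
      (Ideal.mul_mem_left _ _ (deltaPart_obs_Q2local_mem P R (by decide)))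

end Local

end YMQCD

/-! ### Assembly of the three claims. -/

theorem propositionp (N d : ℕ) (G : YMQCD.GaugeData N d) (cF : ℝ)
    (P : YMQCD.GluonOrdering cF) (R : YMQCD.QuarkOrdering G) (B : YMQCD.BilocalOrdering P R) :
    YMQCD.O3loc B ∈ (YMQCD.supportIdeal : Ideal (YMQCD.Expr N d)) ∧
    (YMQCD.IsDerivativeFrom G Set.univ (YMQCD.O3w2 P R) →
      YMQCD.IsDerivativeFrom G Set.univ (YMQCD.O3remain B) →
      ∃ Q3 : Fin 4 → YMQCD.Expr N d, YMQCD.Resolves B 0 Q3) ∧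
    (YMQCD.IsDerivativeFrom G YMQCD.purelyString (YMQCD.O3w2 P R) →
      YMQCD.IsDerivativeFrom G YMQCD.purelyString (YMQCD.O3remain B) →
      ∃ Q3 : Fin 4 → YMQCD.Expr N d,
        (∀ μ, YMQCD.deltaPart (Q3 μ) = 0) ∧ YMQCD.Resolves B 0 Q3) := by
  have hloc := YMQCD.O3loc_mem B
  refine ⟨hloc, ?_, ?_⟩
  · rintro ⟨r, -, h⟩ ⟨r', -, h'⟩
    exact ⟨_, YMQCD.resolves_of_derivatives hloc h h'⟩
  · rintro ⟨r, hr, h⟩ ⟨r', hr', h'⟩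
    refine ⟨_, fun μ => ?_, YMQCD.resolves_of_derivatives hloc h h'⟩
    rw [map_mul, map_add, YMQCD.deltaPart_collect hr, YMQCD.deltaPart_collect hr', add_zero,
      mul_zero]
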